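/- Let $G$ be an $n$-dimensional real Lie group with Lie algebra $\mathfrak g$ (the left invariant vector fields), and let $TG$ be its tangent Lie group, with multiplication $T\mu(v,w)=T_hL_g\,w+T_gR_h\,v$ for $v\in T_gG$, $w\in T_hG$. For a vector field $X$ on $G$ let $X^v$ and $X^c$ be its vertical and complete lifts to $TG$: $X^v(x,y)$ is the velocity at $t=0$ of $t\mapsto (x,\,y+tX(x))$, and $X^c(x,y)$ is the velocity at $t=0$ of $t\mapsto T\varphi_t(x,y)$, where $\varphi_t$ is the flow of $X$ (equivalently $X^c=\kappa\circ TX$ with $\kappa$ the canonical involution of $TTG$). Let $g^1,g^2$ be left invariant Riemannian metrics on $G$. Then there is a left invariant Riemannian metric $\tilde g$ on $TG$ with $$\tilde g(X^c,Y^c)=g^1(X,Y),\qquad \tilde g(X^v,Y^v)=g^2(X,Y),\qquad \tilde g(X^c,Y^v)=0\qquad (X,Y\in\mathfrak g).$$ It has a Levi-Civita connection $\tilde\nabla$; let $\tilde R(U,V)W=\tilde\nabla_U\tilde\nabla_VW-\tilde\nabla_V\tilde\nabla_UW-\tilde\nabla_{[U,V]}W$ be its curvature tensor. Let $\varphi:\mathfrak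 g\to\mathfrak g$ be the linear map with $g^2(X,Y)=g^1(\varphi X,Y)$ for all $X,Y\in\mathfrak g$, let $X_1,\dots,X_n$ be a $g^1$-orthonormal basis of $\mathfrak g$ with $\varphi X_i=\lambda_iX_i$ (so $\lambda_i>0$), and let $[X_i,X_j]=\sum_k c_{ij}^kX_k$. Write $V_i=\frac{X_i^v}{\sqrt{\lambda_i}}$ and $C_i=X_i^c$, so that $V_1,\dots,V_n,C_1,\dots,C_n$ is a $\tilde g$-orthonormal basis of the Lie algebra of $TG$. Then for all $1\le i,j,k\le n$ (all sums run from $1$ to $n$): $$\begin{aligned} (1)\ \tilde R(C_i,C_j)C_k=\tfrac14\sum_h\sum_l\Big[&(c_{jk}^l-c_{kl}^j+c_{lj}^k)(c_{il}^h-c_{lh}^i+c_{hi}^l)-(c_{ik}^l-c_{kl}^i+c_{li}^k)(c_{jl}^h-c_{lh}^j+c_{hj}^l)\\ &-2c_{ij}^l(c_{lk}^h-c_{kh}^l+c_{hl}^k)\Big]C_h,\\ (2)\ \tilde R(C_i,C_j)V_k=\tfrac14\sum_h\sum_l\Big[&\big(\tfrac{\sqrt{\lambda_l}}{\sqrt{\lambda_k}}c_{jk}^l+\tfrac{\sqrt{\lambda_k}}{\sqrt{\lambda_l}}c_{lj}^k\big)\big(\tfrac{\sqrt{\lambda_h}}{\sqrt{\lambda_l}}c_{il}^h+\tfrac{\sqrt{\lambda_l}}{\sqrt{\lambda_h}}c_{hi}^l\big)\\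 &-\big(\tfrac{\sqrt{\lambda_l}}{\sqrt{\lambda_k}}c_{ik}^l+\tfrac{\sqrt{\lambda_k}}{\sqrt{\lambda_l}}c_{li}^k\big)\big(\tfrac{\sqrt{\lambda_h}}{\sqrt{\lambda_l}}c_{jl}^h+\tfrac{\sqrt{\lambda_l}}{\sqrt{\lambda_h}}c_{hj}^l\big)\\ &-2c_{ij}^l\big(\tfrac{\sqrt{\lambda_h}}{\sqrt{\lambda_k}}c_{lk}^h+\tfrac{\sqrt{\lambda_k}}{\sqrt{\lambda_h}}c_{hl}^k\big)\Big]V_h,\\ (3)\ \tilde R(V_i,C_j)C_k=\tfrac14\sum_h\sum_l\Big[&(c_{jk}^l-c_{kl}^j+c_{lj}^k)\big(\tfrac{\sqrt{\lambda_h}}{\sqrt{\lambda_i}}c_{il}^h-\tfrac{\sqrt{\lambda_i}}{\sqrt{\lambda_h}}c_{lh}^i\big)\\ &-\big(\tfrac{\sqrt{\lambda_l}}{\sqrt{\lambda_i}}c_{ik}^l-\tfrac{\sqrt{\lambda_i}}{\sqrt{\lambda_l}}c_{kl}^i\big)\big(\tfrac{\sqrt{\lambda_h}}{\sqrt{\lambda_l}}c_{jl}^h+\tfrac{\sqrt{\lambda_l}}{\sqrt{\lambda_h}}c_{hj}^l\big)\\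 &-2\tfrac{\sqrt{\lambda_l}}{\sqrt{\lambda_i}}c_{ij}^l\big(\tfrac{\sqrt{\lambda_h}}{\sqrt{\lambda_l}}c_{lk}^h-\tfrac{\sqrt{\lambda_l}}{\sqrt{\lambda_h}}c_{kh}^l\big)\Big]V_h,\\ (4)\ \tilde R(V_i,V_j)C_k=\tfrac14\sum_h\sum_l\Big[&\big(\tfrac{\sqrt{\lambda_l}}{\sqrt{\lambda_j}}c_{jk}^l-\tfrac{\sqrt{\lambda_j}}{\sqrt{\lambda_l}}c_{kl}^j\big)\big(\tfrac{\sqrt{\lambda_l}}{\sqrt{\lambda_i}}c_{hi}^l-\tfrac{\sqrt{\lambda_i}}{\sqrt{\lambda_l}}c_{lh}^i\big)\\ &-\big(\tfrac{\sqrt{\lambda_l}}{\sqrt{\lambda_i}}c_{ik}^l-\tfrac{\sqrt{\lambda_i}}{\sqrt{\lambda_l}}c_{kl}^i\big)\big(\tfrac{\sqrt{\lambda_l}}{\sqrt{\lambda_j}}c_{hj}^l-\tfrac{\sqrt{\lambda_j}}{\sqrt{\lambda_l}}c_{lh}^j\big)\Big]C_h,\\ (5)\ \tilde R(V_i,C_j)V_k=\tfrac14\sum_h\sum_l\Big[&\big(\tfrac{\sqrt{\lambda_l}}{\sqrt{\lambda_k}}c_{jk}^l+\tfrac{\sqrt{\lambda_k}}{\sqrt{\lambda_l}}c_{lj}^k\big)\big(\tfrac{\sqrt{\lambda_l}}{\sqrt{\lambda_i}}c_{hi}^l-\tfrac{\sqrt{\lambda_i}}{\sqrt{\lambda_l}}c_{lh}^i\big)\\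 &-\big(\tfrac{\sqrt{\lambda_k}}{\sqrt{\lambda_i}}c_{li}^k-\tfrac{\sqrt{\lambda_i}}{\sqrt{\lambda_k}}c_{kl}^i\big)(c_{jl}^h-c_{lh}^j+c_{hj}^l)\\ &-2\tfrac{\sqrt{\lambda_l}}{\sqrt{\lambda_i}}c_{ij}^l\big(\tfrac{\sqrt{\lambda_k}}{\sqrt{\lambda_l}}c_{hl}^k-\tfrac{\sqrt{\lambda_l}}{\sqrt{\lambda_k}}c_{kh}^l\big)\Big]C_h,\\ (6)\ \tilde R(V_i,V_j)V_k=\tfrac14\sum_h\sum_l\Big[&\big(\tfrac{\sqrt{\lambda_k}}{\sqrt{\lambda_j}}c_{lj}^k-\tfrac{\sqrt{\lambda_j}}{\sqrt{\lambda_k}}c_{kl}^j\big)\big(\tfrac{\sqrt{\lambda_h}}{\sqrt{\lambda_i}}c_{il}^h-\tfrac{\sqrt{\lambda_i}}{\sqrt{\lambda_h}}c_{lh}^i\big)\\ &-\big(\tfrac{\sqrt{\lambda_k}}{\sqrt{\lambda_i}}c_{li}^k-\tfrac{\sqrt{\lambda_i}}{\sqrt{\lambda_k}}c_{kl}^i\big)\big(\tfrac{\sqrt{\lambda_h}}{\sqrt{\lambda_j}}c_{jl}^h-\tfrac{\sqrt{\lambda_j}}{\sqrt{\lambda_h}}c_{lh}^j\big)\Big]V_h.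 \end{aligned}$$ -/

import Mathlib

open Bundle VectorField
open scoped Manifold ContDiff

noncomputable section

section Lifts

variable {E : Type*} [NormedAddCommGroup E] [NormedSpace ℝ E]
  {H : Type*} [TopologicalSpace H] {I : ModelWithCorners ℝ E H}
  {M : Type*} [TopologicalSpace M] [ChartedSpace H M] [IsManifold I 1 M]

/-- The vertical lift `Xᵛ` to the tangent bundle of a vector field `X` on `M`: its value at `(x, y)`
is the velocity at `t = 0` of the curve `t ↦ (x, y + t X(x))`. -/
def verticalLift (X : (x : M) → TangentSpace I x) (p : TangentBundle I M) :
    TangentSpace I.tangent p :=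
  (mfderiv 𝓘(ℝ, ℝ) I.tangent
    (fun t : ℝ ↦ (⟨p.1, p.2 + t • X p.1⟩ : TangentBundle I M)) 0 (1 : ℝ) : E × E)

/-- The complete lift `Xᶜ` to the tangent bundle of a vector field `X` on `M`, that is `κ ∘ TX`,
where `TX : TM → TTM` is the tangent map of the section `X : M → TM` and `κ` is the canonical
involution of `TTM` that exchanges the two projections to `TM`. (Differentiating the curves
`t ↦ Tφ_t(x, y)` for the flow `φ` of `X` gives the same vector field.)

The tangent space of `TM` at a point over `x` is `E × E` through the preferred chart of `M` at `x`.
In that chart `X` becomes a function `X̂`, the vector `T_x X (y)` is `(y, DX̂(x) y)`, tangent to `TM`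
at `(x, X(x))`, and its image under `κ` is `(X(x), DX̂(x) y)`, tangent to `TM` at `(x, y)`. -/
def completeLift (X : (x : M) → TangentSpace I x) (p : TangentBundle I M) :
    TangentSpace I.tangent p :=
  ((X p.1, (mfderiv I I.tangent (fun x ↦ (⟨x, X x⟩ : TangentBundle I M)) p.1 p.2 : E × E).2) :
    E × E)

end Lifts

section Riemannian

variable {E : Type*} [NormedAddCommGroup E] [NormedSpace ℝ E]
  {H : Type*} [TopologicalSpace H] (I : ModelWithCorners ℝ E H)
  (M : Type*) [TopologicalSpace M] [ChartedSpace H M] [IsManifold I ∞ M]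

/-- Smooth Riemannian metrics on the manifold `M`. -/
abbrev SmoothRiemannianMetric : Type _ :=
  ContMDiffRiemannianMetric I ∞ E (TangentSpace I : M → Type _)

variable {I M}

/-- A Riemannian metric is left invariant if all left translations are isometries. -/
def IsLeftInvariantMetric [Mul M] (g : SmoothRiemannianMetric I M) : Prop :=
  ∀ (a x : M) (u v : TangentSpace I x),
    g.inner (a * x) (mfderiv I I (a * ·) x u) (mfderiv I I (a * ·) x v) = g.inner x u v

/-- `nabla` is a Levi-Civita connection of `g`: it is torsion free, `∇_X Y - ∇_Y X = [X, Y]`, and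
compatible with the metric, `v (g(Y, Z)) = g(∇_v Y, Z) + g(Y, ∇_v Z)`. Here `nabla Z p v` is `∇_v Z`
for a tangent vector `v` at `p`. -/
def IsLeviCivita [FiniteDimensional ℝ E] (g : SmoothRiemannianMetric I M)
    (nabla : CovariantDerivative I E (TangentSpace I : M → Type _)) : Prop :=
  haveI : CompleteSpace E := FiniteDimensional.complete ℝ E
  nabla.torsion = 0 ∧
  ∀ (Y Z : (p : M) → TangentSpace I p) (p : M),
    MDifferentiableAt I I.tangent (fun q ↦ (⟨q, Y q⟩ : TangentBundle I M)) p →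
    MDifferentiableAt I I.tangent (fun q ↦ (⟨q, Z q⟩ : TangentBundle I M)) p →
    ∀ v : TangentSpace I p,
      mvfderiv I (fun q ↦ g.inner q (Y q) (Z q)) p v =
        g.inner p (nabla Y p v) (Z p) + g.inner p (Y p) (nabla Z p v)

/-- The curvature `R(X, Y)Z = ∇_X ∇_Y Z - ∇_Y ∇_X Z - ∇_[X, Y] Z`. Recall that `nabla Z p (X p)` is
`∇_X Z` at the point `p`. -/
def curvature (nabla : CovariantDerivative I E (TangentSpace I : M → Type _))
    (X Y Z : (p : M) → TangentSpace I p) (p : M) : TangentSpace I p :=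
  nabla (fun q ↦ nabla Z q (Y q)) p (X p) - nabla (fun q ↦ nabla Z q (X q)) p (Y p)
    - nabla Z p (mlieBracket I X Y p)

end Riemannian

section TangentGroup

variable {E : Type*} [NormedAddCommGroup E] [NormedSpace ℝ E]
  {H : Type*} [TopologicalSpace H] {I : ModelWithCorners ℝ E H}
  {G : Type*} [TopologicalSpace G] [ChartedSpace H G] [Group G]

/-- The multiplication `Tμ` of the tangent Lie group: for `v` tangent to `G` at `g` and `w` tangent
to `G` at `h`, the product is `T_h L_g w + T_g R_h v`, tangent to `G` at `g * h`. -/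
instance tangentGroupMul : Mul (TangentBundle I G) where
  mul v w := ⟨v.1 * w.1,
    (mfderiv I I (fun x ↦ v.1 * x) w.1 w.2 + mfderiv I I (fun x ↦ x * w.1) v.1 v.2 : E)⟩

/-- `gt` is the lift to the tangent Lie group of the left invariant metrics `g₁` and `g₂`: the left
invariant Riemannian metric with `gt(Xᶜ, Yᶜ) = g₁(X, Y)`, `gt(Xᵛ, Yᵛ) = g₂(X, Y)` and
`gt(Xᶜ, Yᵛ) = 0` for all left invariant vector fields `X` and `Y` on `G`, which are given here by
their values at the identity. -/
structure IsLiftedMetric [LieGroup I ∞ G] (g₁ g₂ : SmoothRiemannianMetric I G)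
    (gt : SmoothRiemannianMetric I.tangent (TangentBundle I G)) : Prop where
  leftInvariant : IsLeftInvariantMetric gt
  complete_complete (X Y : GroupLieAlgebra I G) (p : TangentBundle I G) :
    gt.inner p (completeLift (mulInvariantVectorField X) p)
      (completeLift (mulInvariantVectorField Y) p) = g₁.inner 1 X Y
  vertical_vertical (X Y : GroupLieAlgebra I G) (p : TangentBundle I G) :
    gt.inner p (verticalLift (mulInvariantVectorField X) p)
      (verticalLift (mulInvariantVectorField Y) p) = g₂.inner 1 X Y
  complete_vertical (X Y : GroupLieAlgebra I G) (p : TangentBundle I G) :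
    gt.inner p (completeLift (mulInvariantVectorField X) p)
      (verticalLift (mulInvariantVectorField Y) p) = 0

end TangentGroup

end

noncomputable section

open Filter Topology

section LocalRep

variable {E : Type*} [NormedAddCommGroup E] [NormedSpace ℝ E]
  {H : Type*} [TopologicalSpace H] {I : ModelWithCorners ℝ E H}
  {M : Type*} [TopologicalSpace M] [ChartedSpace H M]

/-- The expression of a vector field in the preferred chart at `x`. -/
def localRep (I : ModelWithCorners ℝ E H) (V : (y : M) → TangentSpace I y) (x : M) (z : E) : E :=
  mfderiv I 𝓘(ℝ, E) (extChartAt I x) ((extChartAt I x).symm z) (V ((extChartAt I x).symm z))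

lemma localRep_extChartAt_self [IsManifold I ∞ M] (V : (y : M) → TangentSpace I y) (x : M) :
    localRep I V x (extChartAt I x x) = V x := by
  unfold localRep
  rw [extChartAt_to_inv, mfderiv_extChartAt_self]
  rfl

lemma localRep_eq_trivializationAt [IsManifold I 1 M] (V : (y : M) → TangentSpace I y) (x : M)
    {z : E} (hz : z ∈ (extChartAt I x).target) :
    localRep I V x z = (trivializationAt E (TangentSpace I) x
      ⟨(extChartAt I x).symm z, V ((extChartAt I x).symm z)⟩).2 := by
  have h : (extChartAt I x).symm z ∈ (chartAt H x).source := by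
    simpa using (extChartAt I x).map_target hz
  unfold localRep
  rw [← TangentBundle.continuousLinearMapAt_trivializationAt h]
  exact congrFun (Trivialization.coe_linearMapAt_of_mem (R := ℝ)
    (trivializationAt E (TangentSpace I) x) h) _

variable [IsManifold I ∞ M] [I.Boundaryless]

lemma localRep_eventuallyEq_mpullbackWithin (V : (y : M) → TangentSpace I y) (x : M) :
    mpullbackWithin 𝓘(ℝ, E) I (extChartAt I x).symm V (Set.range I)
      =ᶠ[𝓝 (extChartAt I x x)] localRep I V x := by
  filter_upwards [extChartAt_target_mem_nhds (I := I) x] with z hz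
  rw [mpullbackWithin_apply]
  rw [ContinuousLinearMap.inverse_eq (mfderivWithin_extChartAt_symm_comp_mfderiv_extChartAt hz)
    (mfderiv_extChartAt_comp_mfderivWithin_extChartAt_symm hz)]
  rfl

lemma mlieBracket_eq_lieBracket_localRep (V W : (y : M) → TangentSpace I y) (x : M) :
    mlieBracket I V W x = lieBracket ℝ (localRep I V x) (localRep I W x) (extChartAt I x x) := by
  rw [← mlieBracketWithin_univ, mlieBracketWithin_apply, mfderiv_extChartAt_self]
  refine (congrArg (fun L : E →L[ℝ] E ↦ L _)
    (ContinuousLinearMap.inverse_id (R := ℝ) (M := E))).trans ?_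
  simp only [I.range_eq_univ, Set.preimage_univ, Set.univ_inter]
  have h := Filter.EventuallyEq.lieBracket_vectorField_eq (𝕜 := ℝ)
    (localRep_eventuallyEq_mpullbackWithin (I := I) V x)
    (localRep_eventuallyEq_mpullbackWithin (I := I) W x)
  rw [I.range_eq_univ] at h
  exact (congrFun (lieBracketWithin_univ (𝕜 := ℝ) (E := E)) _).trans h

lemma differentiableAt_localRep {V : (y : M) → TangentSpace I y} {x : M}
    (hV : MDifferentiableAt I I.tangent (fun y ↦ (⟨y, V y⟩ : TangentBundle I M)) x) :
    DifferentiableAt ℝ (localRep I V x) (extChartAt I x x) := by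
  rw [mdifferentiableAt_section] at hV
  have h := hV.differentiableWithinAt_writtenInExtChartAt
  rw [I.range_eq_univ, differentiableWithinAt_univ] at h
  refine h.congr_of_eventuallyEq ?_
  filter_upwards [extChartAt_target_mem_nhds (I := I) x] with z hz
  rw [localRep_eq_trivializationAt V x hz]
  rfl

lemma mfderiv_section_apply {V : (y : M) → TangentSpace I y} {x : M}
    (hV : MDifferentiableAt I I.tangent (fun y ↦ (⟨y, V y⟩ : TangentBundle I M)) x)
    (v : TangentSpace I x) :
    (mfderiv I I.tangent (fun y ↦ (⟨y, V y⟩ : TangentBundle I M)) x v : E × E) =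
      ((v : E), fderiv ℝ (localRep I V x) (extChartAt I x x) (v : E)) := by
  have hd := differentiableAt_localRep hV
  have key : HasFDerivAt (writtenInExtChartAt I I.tangent x
      (fun y ↦ (⟨y, V y⟩ : TangentBundle I M)))
      ((ContinuousLinearMap.id ℝ E).prod (fderiv ℝ (localRep I V x) (extChartAt I x x)))
      (extChartAt I x x) := by
    refine ((hasFDerivAt_id _).prodMk hd.hasFDerivAt).congr_of_eventuallyEq ?_
    filter_upwards [extChartAt_target_mem_nhds (I := I) x] with z hz
    rw [localRep_eq_trivializationAt V x hz]
    simp only [writtenInExtChartAt, Function.comp]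
    rw [FiberBundle.extChartAt]
    have h : (extChartAt I x).symm z ∈ (chartAt H x).source := by
      simpa using (extChartAt I x).map_target hz
    simp only [PartialEquiv.trans_apply, PartialEquiv.prod_coe, PartialEquiv.refl_coe, id]
    refine Prod.ext ?_ rfl
    exact (extChartAt I x).right_inv hz
  have : mfderiv I I.tangent (fun y ↦ (⟨y, V y⟩ : TangentBundle I M)) x =
      ((ContinuousLinearMap.id ℝ E).prod (fderiv ℝ (localRep I V x) (extChartAt I x x)) :
        E →L[ℝ] E × E) := by
    rw [hV.mfderiv, I.range_eq_univ, fderivWithin_univ]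
    exact key.fderiv
  rw [this]
  rfl

variable {E' : Type*} [NormedAddCommGroup E'] [NormedSpace ℝ E']
  {H' : Type*} [TopologicalSpace H'] {I' : ModelWithCorners ℝ E' H'}
  {M' : Type*} [TopologicalSpace M'] [ChartedSpace H' M'] [IsManifold I' ∞ M']

/-- If `f` relates `V` to `V'`, then the chart expression of `f` relates those of `V` and `V'`. -/
lemma fderiv_writtenInExtChartAt_localRep {f : M → M'} (hf : ContMDiff I I' ∞ f)
    {V : (y : M) → TangentSpace I y} {V' : (y : M') → TangentSpace I' y}
    (h : ∀ y, mfderiv I I' f y (V y) = V' (f y)) (x : M) :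
    ∀ᶠ z in 𝓝 (extChartAt I x x), fderiv ℝ (writtenInExtChartAt I I' x f) z (localRep I V x z) =
      localRep I' V' (f x) (writtenInExtChartAt I I' x f z) := by
  have hc : ∀ᶠ z in 𝓝 (extChartAt I x x),
      f ((extChartAt I x).symm z) ∈ (chartAt H' (f x)).source := by
    have : ContinuousAt (fun z ↦ f ((extChartAt I x).symm z)) (extChartAt I x x) :=
      hf.continuous.continuousAt.comp (continuousAt_extChartAt_symm x)
    refine this.eventually_mem ?_
    rw [extChartAt_to_inv]
    exact chart_source_mem_nhds H' (f x)
  filter_upwards [extChartAt_target_mem_nhds (I := I) x, hc,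
    (hc.and (extChartAt_target_mem_nhds (I := I) x)).eventually_nhds] with z hz hfz hev
  set y := (extChartAt I x).symm z with hy
  have hys : y ∈ (chartAt H x).source := by
    rw [← extChartAt_source I]
    exact (extChartAt I x).map_target hz
  have hzy : extChartAt I x y = z := (extChartAt I x).right_inv hz
  have hφ : MDifferentiableAt I 𝓘(ℝ, E) (extChartAt I x) y := mdifferentiableAt_extChartAt hys
  have hφ' : MDifferentiableAt I' 𝓘(ℝ, E') (extChartAt I' (f x)) (f y) :=
    mdifferentiableAt_extChartAt hfz
  have hfy : MDifferentiableAt I I' f y := hf.mdifferentiableAt (by simp)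
  have hsymm : MDifferentiableAt 𝓘(ℝ, E) I (extChartAt I x).symm z := by
    have := mdifferentiableWithinAt_extChartAt_symm (I := I) hz
    rwa [I.range_eq_univ, mdifferentiableWithinAt_univ] at this
  have hw : MDifferentiableAt 𝓘(ℝ, E) 𝓘(ℝ, E') (writtenInExtChartAt I I' x f) z :=
    hφ'.comp z (hfy.comp z hsymm)
  have e1 : mfderiv I 𝓘(ℝ, E') (writtenInExtChartAt I I' x f ∘ extChartAt I x) y =
      mfderiv I 𝓘(ℝ, E') (extChartAt I' (f x) ∘ f) y := by
    apply Filter.EventuallyEq.mfderiv_eq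
    filter_upwards [(isOpen_extChartAt_source (I := I) x).mem_nhds
      (by simpa using hys : y ∈ (extChartAt I x).source)] with w hw
    simp only [writtenInExtChartAt, Function.comp]
    rw [(extChartAt I x).left_inv hw]
  rw [← hzy] at hw
  rw [mfderiv_comp y hw hφ, mfderiv_comp y hφ' hfy, mfderiv_eq_fderiv, hzy] at e1
  have e2 := congrArg (fun L ↦ L (V y)) e1
  have e3 : localRep I' V' (f x) (writtenInExtChartAt I I' x f z) =
      mfderiv I' 𝓘(ℝ, E') (extChartAt I' (f x)) (f y) (V' (f y)) := by
    have : (extChartAt I' (f x)).symm (writtenInExtChartAt I I' x f z) = f y :=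
      (extChartAt I' (f x)).left_inv (by rwa [extChartAt_source])
    unfold localRep
    rw [this]
  rw [e3, ← h y]
  exact e2

variable [I'.Boundaryless]

/-- Lie brackets of `f`-related vector fields are `f`-related. -/
theorem mfderiv_mlieBracket_of_related {f : M → M'} (hf : ContMDiff I I' ∞ f)
    {V W : (y : M) → TangentSpace I y} {V' W' : (y : M') → TangentSpace I' y}
    (hV : ∀ y, mfderiv I I' f y (V y) = V' (f y))
    (hW : ∀ y, mfderiv I I' f y (W y) = W' (f y)) (x : M)
    (dV : MDifferentiableAt I I.tangent (fun y ↦ (⟨y, V y⟩ : TangentBundle I M)) x)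
    (dW : MDifferentiableAt I I.tangent (fun y ↦ (⟨y, W y⟩ : TangentBundle I M)) x)
    (dV' : MDifferentiableAt I' I'.tangent (fun y ↦ (⟨y, V' y⟩ : TangentBundle I' M')) (f x))
    (dW' : MDifferentiableAt I' I'.tangent (fun y ↦ (⟨y, W' y⟩ : TangentBundle I' M')) (f x)) :
    mfderiv I I' f x (mlieBracket I V W x) = mlieBracket I' V' W' (f x) := by
  set F := writtenInExtChartAt I I' x f with hF
  set z := extChartAt I x x with hz
  have hFz : F z = extChartAt I' (f x) (f x) := by simp [hF, hz, writtenInExtChartAt]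
  have hFs : ContDiffAt ℝ 2 F z := by
    have := (contMDiffAt_iff.1 (hf.contMDiffAt (x := x))).2
    rw [I.range_eq_univ, contDiffWithinAt_univ] at this
    exact this.of_le ENat.LEInfty.out
  have hsymm : IsSymmSndFDerivAt ℝ F z := hFs.isSymmSndFDerivAt (by simp)
  have eV := fderiv_writtenInExtChartAt_localRep hf hV x
  have eW := fderiv_writtenInExtChartAt_localRep hf hW x
  have key := fderiv_apply_lieBracket_of_isSymmSndFDerivAt hFs hsymm
    (differentiableAt_localRep dW) (differentiableAt_localRep dV)
  have hFd : DifferentiableAt ℝ F z := hFs.differentiableAt (by simp)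
  have dV'' := differentiableAt_localRep dV'
  have dW'' := differentiableAt_localRep dW'
  rw [← hFz] at dV'' dW''
  rw [Filter.EventuallyEq.fderiv_eq eV, Filter.EventuallyEq.fderiv_eq eW,
    fderiv_fun_comp (g := localRep I' W' (f x)) z dW'' hFd,
    fderiv_fun_comp (g := localRep I' V' (f x)) z dV'' hFd] at key
  rw [mlieBracket_eq_lieBracket_localRep, mlieBracket_eq_lieBracket_localRep,
    (hf.mdifferentiableAt (by simp) : MDifferentiableAt I I' f x).mfderiv, I.range_eq_univ,
    fderivWithin_univ]
  refine key.trans ?_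
  simp only [ContinuousLinearMap.comp_apply]
  rw [eV.self_of_nhds, eW.self_of_nhds, ← hFz]
  rfl

end LocalRep

section Lifts

variable {E : Type*} [NormedAddCommGroup E] [NormedSpace ℝ E]
  {H : Type*} [TopologicalSpace H] {I : ModelWithCorners ℝ E H}
  {M : Type*} [TopologicalSpace M] [ChartedSpace H M]

lemma tangentBundle_ext {p q : TangentBundle I M} (h₁ : p.1 = q.1)
    (h₂ : (p.2 : E) = (q.2 : E)) : p = q := by
  cases p; cases q; cases h₁; cases h₂; rfl

variable [IsManifold I ∞ M]

lemma trivializationAt_self_apply (x : M) (v : TangentSpace I x) :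
    (trivializationAt E (TangentSpace I) x (⟨x, v⟩ : TangentBundle I M)).2 = v := by
  obtain ⟨U, rfl⟩ : ∃ U : (y : M) → TangentSpace I y, U x = v := by
    classical
    exact ⟨Function.update (fun y ↦ (0 : TangentSpace I y)) x v, Function.update_self ..⟩
  have h := localRep_eq_trivializationAt U x (mem_extChartAt_target x)
  rw [localRep_extChartAt_self, extChartAt_to_inv] at h
  exact h.symm

/-- The inclusion of a fiber in the tangent bundle. -/
lemma contMDiff_fiberInclusion (x : M) :
    ContMDiff 𝓘(ℝ, E) I.tangent ∞ (fun v : E ↦ (⟨x, v⟩ : TangentBundle I M)) := by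
  intro v
  rw [Bundle.contMDiffAt_totalSpace]
  refine ⟨contMDiffAt_const, ?_⟩
  refine contMDiffAt_id.congr_of_eventuallyEq (Eventually.of_forall fun w ↦ ?_)
  exact trivializationAt_self_apply x w

lemma mfderiv_fiberInclusion (x : M) (v w : E) :
    (mfderiv 𝓘(ℝ, E) I.tangent (fun v : E ↦ (⟨x, v⟩ : TangentBundle I M)) v w : E × E) =
      (0, w) := by
  have hd : MDifferentiableAt 𝓘(ℝ, E) I.tangent (fun v : E ↦ (⟨x, v⟩ : TangentBundle I M)) v :=
    (contMDiff_fiberInclusion x).mdifferentiableAt (by simp)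
  have key : HasFDerivAt (writtenInExtChartAt 𝓘(ℝ, E) I.tangent v
      (fun v : E ↦ (⟨x, v⟩ : TangentBundle I M)))
      ((0 : E →L[ℝ] E).prod (ContinuousLinearMap.id ℝ E)) v := by
    refine ((hasFDerivAt_const (extChartAt I x x) v).prodMk
      (hasFDerivAt_id v)).congr_of_eventuallyEq (Eventually.of_forall fun w ↦ ?_)
    simp only [writtenInExtChartAt, Function.comp]
    rw [FiberBundle.extChartAt]
    simp only [PartialEquiv.trans_apply, PartialEquiv.prod_coe, PartialEquiv.refl_coe, id]
    refine Prod.ext rfl ?_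
    exact trivializationAt_self_apply x w
  have : mfderiv 𝓘(ℝ, E) I.tangent (fun v : E ↦ (⟨x, v⟩ : TangentBundle I M)) v =
      ((0 : E →L[ℝ] E).prod (ContinuousLinearMap.id ℝ E) : E →L[ℝ] E × E) := by
    rw [hd.mfderiv, modelWithCornersSelf_coe, Set.range_id, fderivWithin_univ]
    exact key.fderiv
  rw [this]
  rfl

/-- The tangent vector of `TM` at `p` given by a vector in the fiber through `p`. -/
def verticalVector (p : TangentBundle I M) (w : TangentSpace I p.1) : TangentSpace I.tangent p :=
  ((0, w) : E × E)

lemma mfderiv_fiberLine (x : M) (v w : E) :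
    (mfderiv 𝓘(ℝ, ℝ) I.tangent (fun t : ℝ ↦ (⟨x, v + t • w⟩ : TangentBundle I M)) 0 (1 : ℝ) :
      E × E) = (0, w) := by
  have h₁ : MDifferentiableAt 𝓘(ℝ, E) I.tangent (fun v : E ↦ (⟨x, v⟩ : TangentBundle I M))
      (v + (0 : ℝ) • w) :=
    (contMDiff_fiberInclusion x).mdifferentiableAt (by simp)
  have h₂ : HasFDerivAt (fun t : ℝ ↦ v + t • w)
      ((ContinuousLinearMap.id ℝ ℝ).smulRight w) 0 :=
    ((hasFDerivAt_id (𝕜 := ℝ) (0 : ℝ)).smul_const w).const_add v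
  have h := (h₁.hasMFDerivAt.comp (0 : ℝ) h₂.hasMFDerivAt).mfderiv
  refine (congrArg (fun L : ℝ →L[ℝ] E × E ↦ L 1) h).trans ?_
  refine (mfderiv_fiberInclusion x _ _).trans ?_
  exact Prod.ext rfl (one_smul ℝ w)

lemma verticalLift_eq (X : (x : M) → TangentSpace I x) (p : TangentBundle I M) :
    verticalLift X p = verticalVector p (X p.1) :=
  mfderiv_fiberLine (E := E) p.1 p.2 (X p.1)

lemma completeLift_eq [I.Boundaryless] {X : (x : M) → TangentSpace I x} {x : M}
    (hX : MDifferentiableAt I I.tangent (fun y ↦ (⟨y, X y⟩ : TangentBundle I M)) x)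
    (y : TangentSpace I x) :
    (completeLift X ⟨x, y⟩ : E × E) =
      (X x, fderiv ℝ (localRep I X x) (extChartAt I x x) (y : E)) := by
  have h := congrArg Prod.snd (mfderiv_section_apply hX y)
  exact Prod.ext rfl h

/-- The complete lift of `X` along a vector field `Y`, in terms of the derivative of `Y` along `X`
and of the Lie bracket. -/
theorem completeLift_section [I.Boundaryless] {X Y : (x : M) → TangentSpace I x} {x : M}
    (hX : MDifferentiableAt I I.tangent (fun y ↦ (⟨y, X y⟩ : TangentBundle I M)) x)
    (hY : MDifferentiableAt I I.tangent (fun y ↦ (⟨y, Y y⟩ : TangentBundle I M)) x) :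
    completeLift X ⟨x, Y x⟩ =
      mfderiv I I.tangent (fun y ↦ (⟨y, Y y⟩ : TangentBundle I M)) x (X x)
        + verticalVector ⟨x, Y x⟩ (mlieBracket I Y X x) := by
  have h := mfderiv_section_apply hY (X x)
  have key : ∀ (a b d : E) (u : E × E), u = (a, b) → (a, d) = u + (0, d - b) := by
    rintro a b d u rfl
    simp
  have hb : lieBracket ℝ (localRep I Y x) (localRep I X x) (extChartAt I x x) =
      fderiv ℝ (localRep I X x) (extChartAt I x x) (Y x) -
        fderiv ℝ (localRep I Y x) (extChartAt I x x) (X x) := by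
    rw [← localRep_extChartAt_self X, ← localRep_extChartAt_self Y]
    rfl
  rw [completeLift_eq hX, mlieBracket_eq_lieBracket_localRep, hb]
  exact key _ _ _ _ h

end Lifts

section Product

variable {E : Type*} [NormedAddCommGroup E] [NormedSpace ℝ E]
  {H : Type*} [TopologicalSpace H] {I : ModelWithCorners ℝ E H}
  {M : Type*} [TopologicalSpace M] [ChartedSpace H M] [IsManifold I ∞ M]
  {E' : Type*} [NormedAddCommGroup E'] [NormedSpace ℝ E']
  {H' : Type*} [TopologicalSpace H'] {I' : ModelWithCorners ℝ E' H'}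
  {M' : Type*} [TopologicalSpace M'] [ChartedSpace H' M'] [IsManifold I' ∞ M']

/-- The vector field on a product with given components. -/
def prodField (V : (x : M) → TangentSpace I x) (V' : (x : M') → TangentSpace I' x)
    (p : M × M') : TangentSpace (I.prod I') p :=
  ((V p.1 : E), (V' p.2 : E'))

variable {V W : (x : M) → TangentSpace I x} {V' W' : (x : M') → TangentSpace I' x}

lemma mdifferentiable_prodField
    (hV : MDifferentiable I I.tangent (fun y ↦ (⟨y, V y⟩ : TangentBundle I M)))
    (hV' : MDifferentiable I' I'.tangent (fun y ↦ (⟨y, V' y⟩ : TangentBundle I' M'))) :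
    MDifferentiable (I.prod I') (I.prod I').tangent
      (fun p ↦ (⟨p, prodField V V' p⟩ : TangentBundle (I.prod I') (M × M'))) := by
  have h : MDifferentiable (I.tangent.prod I'.tangent) (I.prod I').tangent
      (equivTangentBundleProd I M I' M').symm :=
    contMDiff_equivTangentBundleProd_symm.mdifferentiable (n := 1) (by simp)
  exact h.comp ((hV.comp mdifferentiable_fst).prodMk (hV'.comp mdifferentiable_snd))

theorem mlieBracket_prodField [I.Boundaryless] [I'.Boundaryless]
    (hV : MDifferentiable I I.tangent (fun y ↦ (⟨y, V y⟩ : TangentBundle I M)))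
    (hV' : MDifferentiable I' I'.tangent (fun y ↦ (⟨y, V' y⟩ : TangentBundle I' M')))
    (hW : MDifferentiable I I.tangent (fun y ↦ (⟨y, W y⟩ : TangentBundle I M)))
    (hW' : MDifferentiable I' I'.tangent (fun y ↦ (⟨y, W' y⟩ : TangentBundle I' M')))
    (p : M × M') :
    mlieBracket (I.prod I') (prodField V V') (prodField W W') p =
      ((mlieBracket I V W p.1 : E), (mlieBracket I' V' W' p.2 : E')) := by
  have d₁ := mdifferentiable_prodField hV hV' p
  have d₂ := mdifferentiable_prodField hW hW' p
  refine Prod.ext ?_ ?_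
  · refine Eq.trans ?_ (mfderiv_mlieBracket_of_related (I := I.prod I') (I' := I)
      (f := (Prod.fst : M × M' → M)) contMDiff_fst (V := prodField V V') (W := prodField W W')
      (V' := V) (W' := W) ?_ ?_ p d₁ d₂ (hV _) (hW _))
    · rw [mfderiv_fst]; rfl
    · intro y; rw [mfderiv_fst]; rfl
    · intro y; rw [mfderiv_fst]; rfl
  · refine Eq.trans ?_ (mfderiv_mlieBracket_of_related (I := I.prod I') (I' := I')
      (f := (Prod.snd : M × M' → M')) contMDiff_snd (V := prodField V V') (W := prodField W W')
      (V' := V') (W' := W') ?_ ?_ p d₁ d₂ (hV' _) (hW' _))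
    · rw [mfderiv_snd]; rfl
    · intro y; rw [mfderiv_snd]; rfl
    · intro y; rw [mfderiv_snd]; rfl

end Product

section TangentGroup

variable {E : Type*} [NormedAddCommGroup E] [NormedSpace ℝ E]
  {H : Type*} [TopologicalSpace H] {I : ModelWithCorners ℝ E H}
  {G : Type*} [TopologicalSpace G] [ChartedSpace H G] [Group G] [LieGroup I ∞ G]

lemma mdifferentiableAt_mul_left' (g h : G) : MDifferentiableAt I I (fun x : G ↦ g * x) h :=
  (contMDiff_mul_left (I := I) (n := ∞) (a := g)).mdifferentiableAt (by simp)

lemma mdifferentiableAt_mul_right' (g h : G) : MDifferentiableAt I I (fun x : G ↦ x * g) h :=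
  (contMDiff_mul_right (I := I) (n := ∞) (a := g)).mdifferentiableAt (by simp)

lemma mfderiv_mul_eq (g h : G) (v : TangentSpace I g) (w : TangentSpace I h) :
    mfderiv (I.prod I) I (fun p : G × G ↦ p.1 * p.2) (g, h) ((v, w) : E × E) =
      mfderiv I I (fun x ↦ x * h) g v + mfderiv I I (fun x ↦ g * x) h w :=
  mfderiv_prod_eq_add_apply ((contMDiff_mul I ∞).mdifferentiableAt (by simp))

/-- The multiplication of the tangent group is smooth. -/
lemma contMDiff_tangentMul : ContMDiff (I.tangent.prod I.tangent) I.tangent ∞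
    (fun p : TangentBundle I G × TangentBundle I G ↦ p.1 * p.2) := by
  have h₁ : ContMDiff (I.prod I).tangent I.tangent ∞
      (tangentMap (I.prod I) I (fun p : G × G ↦ p.1 * p.2)) :=
    (contMDiff_mul I ∞).contMDiff_tangentMap (by simp)
  have h₂ := h₁.comp (contMDiff_equivTangentBundleProd_symm (I := I) (M := G) (I' := I) (M' := G))
  refine h₂.congr fun p ↦ tangentBundle_ext rfl ?_
  exact (add_comm _ _).trans (mfderiv_mul_eq p.1.1 p.2.1 p.1.2 p.2.2).symm

omit [Group G] [LieGroup I ∞ G] in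
lemma mfderiv_of_eq_id {f : G → G} (hf : f = id) (x : G) :
    (mfderiv I I f x : E →L[ℝ] E) = ContinuousLinearMap.id ℝ E := by
  subst hf
  exact mfderiv_id

omit [LieGroup I ∞ G] in
lemma tangentMul_one (p : TangentBundle I G) : p * (⟨1, (0 : E)⟩ : TangentBundle I G) = p := by
  refine tangentBundle_ext (mul_one _) ?_
  have h : mfderiv I I (fun x : G ↦ x * 1) p.1 = ContinuousLinearMap.id ℝ E :=
    mfderiv_of_eq_id (funext mul_one) _
  have h' : mfderiv I I (fun x : G ↦ p.1 * x) 1 0 = 0 := map_zero _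
  change (mfderiv I I (fun x : G ↦ p.1 * x) 1 0 + mfderiv I I (fun x : G ↦ x * 1) p.1 p.2 : E) = _
  rw [h, h']
  exact zero_add _

/-- The right invariant vector field with a given value at the identity. -/
def rightInvariantField (u : GroupLieAlgebra I G) (g : G) : TangentSpace I g :=
  (mfderiv I I (fun x ↦ x * g) (1 : G) u : E)

lemma mfderiv_mul_left_mulInvariantVectorField (v : GroupLieAlgebra I G) (g h : G) :
    mfderiv I I (fun x ↦ g * x) h (mulInvariantVectorField v h) =
      mulInvariantVectorField v (g * h) := by
  have e : (fun x : G ↦ g * h * x) = (fun x ↦ g * x) ∘ (fun x ↦ h * x) := by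
    ext x; simp [mul_assoc]
  have h₁ := mfderiv_comp (I := I) (I' := I) (I'' := I) (1 : G)
    (mdifferentiableAt_mul_left' g (h * 1)) (mdifferentiableAt_mul_left' (I := I) h 1)
  rw [← e] at h₁
  have h₂ := congrArg (fun L : E →L[ℝ] E ↦ L v) h₁
  have h₃ : (mfderiv I I (fun x ↦ g * x) (h * 1) : E →L[ℝ] E) = mfderiv I I (fun x ↦ g * x) h :=
    mfderiv_congr_point (mul_one h)
  refine Eq.trans ?_ h₂.symm
  exact congrArg (fun L : E →L[ℝ] E ↦ L (mulInvariantVectorField v h)) h₃.symm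

lemma mfderiv_mul_right_rightInvariantField (u : GroupLieAlgebra I G) (g h : G) :
    mfderiv I I (fun x ↦ x * h) g (rightInvariantField u g) =
      rightInvariantField u (g * h) := by
  have e : (fun x : G ↦ x * (g * h)) = (fun x ↦ x * h) ∘ (fun x ↦ x * g) := by
    ext x; simp [mul_assoc]
  have h₁ := mfderiv_comp (I := I) (I' := I) (I'' := I) (1 : G)
    (mdifferentiableAt_mul_right' h (1 * g)) (mdifferentiableAt_mul_right' (I := I) g 1)
  rw [← e] at h₁
  have h₂ := congrArg (fun L : E →L[ℝ] E ↦ L u) h₁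
  have h₃ : (mfderiv I I (fun x ↦ x * h) (1 * g) : E →L[ℝ] E) = mfderiv I I (fun x ↦ x * h) g :=
    mfderiv_congr_point (one_mul g)
  refine Eq.trans ?_ h₂.symm
  exact congrArg (fun L : E →L[ℝ] E ↦ L (rightInvariantField u g)) h₃.symm

lemma exists_mulInvariantVectorField_eq (g : G) (w : TangentSpace I g) :
    ∃ v : GroupLieAlgebra I G, mulInvariantVectorField v g = w := by
  have e : (fun x : G ↦ g * x) ∘ (fun x ↦ g⁻¹ * x) = id := by
    ext x; simp
  have h₁ := mfderiv_comp (I := I) (I' := I) (I'' := I) g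
    (mdifferentiableAt_mul_left' g (g⁻¹ * g)) (mdifferentiableAt_mul_left' (I := I) g⁻¹ g)
  rw [e, mfderiv_id] at h₁
  have h₂ := congrArg (fun L : E →L[ℝ] E ↦ L w) h₁
  have h₃ : (mfderiv I I (fun x ↦ g * x) (g⁻¹ * g) : E →L[ℝ] E) = mfderiv I I (fun x ↦ g * x) 1 :=
    mfderiv_congr_point (inv_mul_cancel g)
  refine ⟨(mfderiv I I (fun x ↦ g⁻¹ * x) g w : E), Eq.trans ?_ h₂.symm⟩
  exact congrArg (fun L : E →L[ℝ] E ↦ L (mfderiv I I (fun x ↦ g⁻¹ * x) g w : E)) h₃.symm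

lemma exists_rightInvariantField_eq (g : G) (w : TangentSpace I g) :
    ∃ v : GroupLieAlgebra I G, rightInvariantField v g = w := by
  have e : (fun x : G ↦ x * g) ∘ (fun x ↦ x * g⁻¹) = id := by
    ext x; simp
  have h₁ := mfderiv_comp (I := I) (I' := I) (I'' := I) g
    (mdifferentiableAt_mul_right' g (g * g⁻¹)) (mdifferentiableAt_mul_right' (I := I) g⁻¹ g)
  rw [e, mfderiv_id] at h₁
  have h₂ := congrArg (fun L : E →L[ℝ] E ↦ L w) h₁
  have h₃ : (mfderiv I I (fun x ↦ x * g) (g * g⁻¹) : E →L[ℝ] E) = mfderiv I I (fun x ↦ x * g) 1 :=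
    mfderiv_congr_point (mul_inv_cancel g)
  refine ⟨(mfderiv I I (fun x ↦ x * g⁻¹) g w : E), Eq.trans ?_ h₂.symm⟩
  exact congrArg (fun L : E →L[ℝ] E ↦ L (mfderiv I I (fun x ↦ x * g⁻¹) g w : E)) h₃.symm

/-- The left trivialization `(g, v) ↦ T_1 L_g v` of the tangent bundle of a Lie group. -/
def leftTrivialization (p : G × E) : TangentBundle I G :=
  ⟨p.1, mulInvariantVectorField (I := I) (p.2 : E) p.1⟩

lemma contMDiff_leftTrivialization :
    ContMDiff (I.prod 𝓘(ℝ, E)) I.tangent ∞ (leftTrivialization (I := I) (G := G)) := by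
  have h₁ : ContMDiff I I.tangent ∞ (fun g : G ↦ (⟨g, (0 : E)⟩ : TangentBundle I G)) :=
    contMDiff_zeroSection ℝ (TangentSpace I)
  have h₂ := contMDiff_fiberInclusion (I := I) (1 : G)
  have h := (contMDiff_tangentMul (I := I) (G := G)).comp
    ((h₁.comp contMDiff_fst).prodMk (h₂.comp (contMDiff_snd (I := I) (J := 𝓘(ℝ, E)))))
  refine h.congr fun p ↦ tangentBundle_ext (mul_one _).symm ?_
  have h' : mfderiv I I (fun x : G ↦ x * 1) p.1 0 = 0 := map_zero _
  change (mfderiv I I (fun x : G ↦ p.1 * x) 1 p.2 : E) =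
    (mfderiv I I (fun x : G ↦ p.1 * x) 1 p.2 + mfderiv I I (fun x : G ↦ x * 1) p.1 0 : E)
  rw [h']
  exact (add_zero _).symm

lemma contMDiff_mulInvariantVectorField_top (v : GroupLieAlgebra I G) :
    ContMDiff I I.tangent ∞
      (fun g : G ↦ (⟨g, mulInvariantVectorField v g⟩ : TangentBundle I G)) :=
  (contMDiff_leftTrivialization (I := I) (G := G)).comp
    (contMDiff_id.prodMk (contMDiff_const : ContMDiff I 𝓘(ℝ, E) ∞ fun _ : G ↦ (show E from v)))

lemma contMDiff_rightInvariantField (v : GroupLieAlgebra I G) :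
    ContMDiff I I.tangent ∞
      (fun g : G ↦ (⟨g, rightInvariantField v g⟩ : TangentBundle I G)) := by
  have h₁ : ContMDiff I I.tangent ∞ (fun g : G ↦ (⟨g, (0 : E)⟩ : TangentBundle I G)) :=
    contMDiff_zeroSection ℝ (TangentSpace I)
  have h := (contMDiff_tangentMul (I := I) (G := G)).comp
    ((contMDiff_const (c := (⟨1, v⟩ : TangentBundle I G))).prodMk h₁)
  refine h.congr fun g ↦ tangentBundle_ext (one_mul _).symm ?_
  have h' : mfderiv I I (fun x : G ↦ 1 * x) g 0 = 0 := map_zero _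
  change (mfderiv I I (fun x : G ↦ x * g) 1 v : E) =
    (mfderiv I I (fun x : G ↦ 1 * x) g 0 + mfderiv I I (fun x : G ↦ x * g) 1 v : E)
  rw [h']
  exact (zero_add _).symm

lemma mdifferentiable_mulInvariantVectorField_top (v : GroupLieAlgebra I G) :
    MDifferentiable I I.tangent
      (fun g : G ↦ (⟨g, mulInvariantVectorField v g⟩ : TangentBundle I G)) :=
  (contMDiff_mulInvariantVectorField_top v).mdifferentiable (by simp)

lemma mdifferentiable_rightInvariantField (v : GroupLieAlgebra I G) :
    MDifferentiable I I.tangent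
      (fun g : G ↦ (⟨g, rightInvariantField v g⟩ : TangentBundle I G)) :=
  (contMDiff_rightInvariantField v).mdifferentiable (by simp)

/-- Left and right invariant vector fields commute. -/
lemma mlieBracket_rightInvariantField [I.Boundaryless] (u v : GroupLieAlgebra I G) (g : G) :
    mlieBracket I (rightInvariantField u) (mulInvariantVectorField v) g = 0 := by
  have hz : MDifferentiable I I.tangent
      (fun y ↦ (⟨y, (0 : (x : G) → TangentSpace I x) y⟩ : TangentBundle I G)) :=
    (contMDiff_zeroSection (n := 1) ℝ (TangentSpace I)).mdifferentiable (by simp)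
  have hu := mdifferentiable_rightInvariantField u
  have hv := mdifferentiable_mulInvariantVectorField_top v
  have h := mfderiv_mlieBracket_of_related (I := I.prod I) (I' := I)
    (f := fun p : G × G ↦ p.1 * p.2) (contMDiff_mul I ∞)
    (V := prodField (rightInvariantField u) 0) (W := prodField 0 (mulInvariantVectorField v))
    (V' := rightInvariantField u) (W' := mulInvariantVectorField v) ?_ ?_ (g, 1)
    (mdifferentiable_prodField hu hz _) (mdifferentiable_prodField hz hv _) (hu _) (hv _)
  · rw [mlieBracket_prodField hu hz hz hv, mlieBracket_zero_right, mlieBracket_zero_left] at h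
    have h' := h.symm.trans (map_zero (mfderiv (I.prod I) I (fun p : G × G ↦ p.1 * p.2) (g, 1)))
    change (mlieBracket I (rightInvariantField u) (mulInvariantVectorField v) (g * 1) : E) = 0 at h'
    rw [mul_one] at h'
    exact h'
  · intro p
    refine (mfderiv_mul_eq p.1 p.2 (rightInvariantField u p.1) 0).trans ?_
    rw [mfderiv_mul_right_rightInvariantField, map_zero]
    exact add_zero _
  · intro p
    refine (mfderiv_mul_eq p.1 p.2 0 (mulInvariantVectorField v p.2)).trans ?_
    rw [mfderiv_mul_left_mulInvariantVectorField, map_zero]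
    exact zero_add _

end TangentGroup

section LiftInvariance

variable {E : Type*} [NormedAddCommGroup E] [NormedSpace ℝ E] [CompleteSpace E]
  {H : Type*} [TopologicalSpace H] {I : ModelWithCorners ℝ E H}
  {G : Type*} [TopologicalSpace G] [ChartedSpace H G] [Group G] [LieGroup I ∞ G]

omit [CompleteSpace E] in
lemma contMDiff_tangentMul_left (a : TangentBundle I G) :
    ContMDiff I.tangent I.tangent ∞ (fun p : TangentBundle I G ↦ a * p) :=
  (contMDiff_tangentMul (I := I) (G := G)).comp (contMDiff_const.prodMk contMDiff_id)

omit [CompleteSpace E] in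
lemma mdifferentiableAt_tangentMul_left (a p : TangentBundle I G) :
    MDifferentiableAt I.tangent I.tangent (fun p : TangentBundle I G ↦ a * p) p :=
  (contMDiff_tangentMul_left a).mdifferentiableAt (by simp)

omit [CompleteSpace E] in
lemma mfderiv_tangentMul_left_verticalVector (a p : TangentBundle I G) (w : TangentSpace I p.1) :
    mfderiv I.tangent I.tangent (fun p : TangentBundle I G ↦ a * p) p (verticalVector p w) =
      verticalVector (a * p) (mfderiv I I (fun x ↦ a.1 * x) p.1 w) := by
  let L : E →L[ℝ] E := mfderiv I I (fun x ↦ a.1 * x) p.1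
  let b : E := mfderiv I I (fun x ↦ x * p.1) a.1 a.2
  let v₀ : E := p.2
  have e : (fun q : TangentBundle I G ↦ a * q) ∘ (fun v : E ↦ (⟨p.1, v⟩ : TangentBundle I G)) =
      (fun v : E ↦ (⟨a.1 * p.1, v⟩ : TangentBundle I G)) ∘ (fun v : E ↦ L v + b) := rfl
  have hb : HasMFDerivAt 𝓘(ℝ, E) 𝓘(ℝ, E) (fun v : E ↦ L v + b) v₀ L :=
    (L.hasFDerivAt.add_const b).hasMFDerivAt
  have h₁ := mfderiv_comp (I := 𝓘(ℝ, E)) (I' := I.tangent) (I'' := I.tangent) v₀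
    (mdifferentiableAt_tangentMul_left a ⟨p.1, v₀⟩)
    ((contMDiff_fiberInclusion (I := I) p.1).mdifferentiableAt (by simp))
  have h₂ := (((contMDiff_fiberInclusion (I := I) (a.1 * p.1)).mdifferentiableAt
    (by simp)).hasMFDerivAt.comp v₀ hb).mfderiv
  rw [e] at h₁
  have h₃ := congrArg (fun L : E →L[ℝ] E × E ↦ L w) (h₁.symm.trans h₂)
  have h₄ : mfderiv 𝓘(ℝ, E) I.tangent (fun v : E ↦ (⟨p.1, v⟩ : TangentBundle I G)) p.2 w =
      verticalVector p w := mfderiv_fiberInclusion (E := E) p.1 p.2 w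
  refine Eq.trans ?_ (h₃.trans (mfderiv_fiberInclusion (a.1 * p.1) _ _))
  exact congrArg (mfderiv I.tangent I.tangent (fun p : TangentBundle I G ↦ a * p) p) h₄.symm

omit [CompleteSpace E] in
/-- Vertical lifts of left invariant vector fields are left invariant. -/
lemma mfderiv_tangentMul_left_verticalLift (X : GroupLieAlgebra I G) (a p : TangentBundle I G) :
    mfderiv I.tangent I.tangent (fun p : TangentBundle I G ↦ a * p) p
      (verticalLift (mulInvariantVectorField X) p) =
      verticalLift (mulInvariantVectorField X) (a * p) := by
  rw [verticalLift_eq, verticalLift_eq, mfderiv_tangentMul_left_verticalVector,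
    mfderiv_mul_left_mulInvariantVectorField]
  rfl

omit [CompleteSpace E] in
lemma lieGroup_minSmoothness : LieGroup I (minSmoothness ℝ 3) G := by
  rw [minSmoothness_of_isRCLikeNormedField]
  infer_instance

lemma mlieBracket_mulInvariantVectorField (X Y : GroupLieAlgebra I G) (g : G) :
    mlieBracket I (mulInvariantVectorField X) (mulInvariantVectorField Y) g =
      mulInvariantVectorField ⁅X, Y⁆ g := by
  have := lieGroup_minSmoothness (I := I) (G := G)
  rw [GroupLieAlgebra.bracket_def, mulInvariantVector_mlieBracket]

variable [I.Boundaryless]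

lemma completeLift_mulInvariantVectorField (X v : GroupLieAlgebra I G) (g : G) :
    completeLift (mulInvariantVectorField X) ⟨g, mulInvariantVectorField v g⟩ =
      mfderiv I I.tangent (fun y ↦ (⟨y, mulInvariantVectorField v y⟩ : TangentBundle I G)) g
        (mulInvariantVectorField X g)
      + verticalVector ⟨g, mulInvariantVectorField v g⟩ (mulInvariantVectorField ⁅v, X⁆ g) := by
  rw [completeLift_section (mdifferentiable_mulInvariantVectorField_top X g)
    (mdifferentiable_mulInvariantVectorField_top v g), mlieBracket_mulInvariantVectorField]

/-- Complete lifts of left invariant vector fields are left invariant. -/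
lemma mfderiv_tangentMul_left_completeLift (X : GroupLieAlgebra I G) (a p : TangentBundle I G) :
    mfderiv I.tangent I.tangent (fun p : TangentBundle I G ↦ a * p) p
      (completeLift (mulInvariantVectorField X) p) =
      completeLift (mulInvariantVectorField X) (a * p) := by
  obtain ⟨g, α⟩ := a
  obtain ⟨h, w⟩ := p
  obtain ⟨u, rfl⟩ := exists_rightInvariantField_eq g α
  obtain ⟨v, rfl⟩ := exists_mulInvariantVectorField_eq h w
  set S : (x : G) → TangentSpace I x := mulInvariantVectorField v + rightInvariantField u with hS
  have hv := mdifferentiable_mulInvariantVectorField_top v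
  have hSd : MDifferentiable I I.tangent (fun y ↦ (⟨y, S y⟩ : TangentBundle I G)) :=
    mdifferentiable_add_section hv (mdifferentiable_rightInvariantField u)
  have hmul : ∀ x, (⟨g, rightInvariantField u g⟩ : TangentBundle I G) *
      ⟨x, mulInvariantVectorField v x⟩ = ⟨g * x, S (g * x)⟩ := by
    intro x
    refine tangentBundle_ext rfl ?_
    exact congrArg₂ (fun a b : E ↦ a + b) (mfderiv_mul_left_mulInvariantVectorField v g x)
      (mfderiv_mul_right_rightInvariantField u g x)
  have hb : mlieBracket I S (mulInvariantVectorField X) (g * h) =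
      mulInvariantVectorField ⁅v, X⁆ (g * h) := by
    rw [hS, mlieBracket_add_left (hv _) (mdifferentiable_rightInvariantField u _),
      mlieBracket_rightInvariantField, mlieBracket_mulInvariantVectorField, add_zero]
  have hc := completeLift_section
    (mdifferentiable_mulInvariantVectorField_top X (g * h)) (hSd (g * h))
  rw [hb] at hc
  set a : TangentBundle I G := ⟨g, rightInvariantField u g⟩ with ha
  have e : (fun q : TangentBundle I G ↦ a * q) ∘
      (fun y ↦ (⟨y, mulInvariantVectorField v y⟩ : TangentBundle I G)) =
      (fun y ↦ (⟨y, S y⟩ : TangentBundle I G)) ∘ (fun y ↦ g * y) := funext hmul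
  have h₁ := mfderiv_comp (I := I) (I' := I.tangent) (I'' := I.tangent) h
    (mdifferentiableAt_tangentMul_left a ⟨h, mulInvariantVectorField v h⟩) (hv h)
  have h₂ := mfderiv_comp (I := I) (I' := I) (I'' := I.tangent) h
    (hSd (g * h)) (mdifferentiableAt_mul_left' (I := I) g h)
  rw [e] at h₁
  have h₃ := congrArg (fun L : E →L[ℝ] E × E ↦ L (mulInvariantVectorField X h)) (h₁.symm.trans h₂)
  rw [completeLift_mulInvariantVectorField, map_add, mfderiv_tangentMul_left_verticalVector,
    mfderiv_mul_left_mulInvariantVectorField]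
  have h₄ : (mfderiv I I.tangent (fun y ↦ (⟨y, S y⟩ : TangentBundle I G)) (g * h)
      (mfderiv I I (fun y ↦ g * y) h (mulInvariantVectorField X h)) : E × E) =
      mfderiv I I.tangent (fun y ↦ (⟨y, S y⟩ : TangentBundle I G)) (g * h)
        (mulInvariantVectorField X (g * h)) := by
    rw [mfderiv_mul_left_mulInvariantVectorField]
  have h₅ := congrArg (fun z : E × E ↦ z + (0, (mulInvariantVectorField ⁅v, X⁆ (g * h) : E)))
    (h₃.trans h₄)
  refine h₅.trans (hc.symm.trans ?_)
  rw [hmul h]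

end LiftInvariance

section LiftSmooth

variable {E : Type*} [NormedAddCommGroup E] [NormedSpace ℝ E]
  {H : Type*} [TopologicalSpace H] {I : ModelWithCorners ℝ E H}
  {G : Type*} [TopologicalSpace G] [ChartedSpace H G] [Group G] [LieGroup I ∞ G]

/-- Left invariant vector fields on the tangent group are smooth. -/
lemma contMDiff_of_tangentMul_left_invariant
    {Z : (p : TangentBundle I G) → TangentSpace I.tangent p}
    (hZ : ∀ a p : TangentBundle I G,
      mfderiv I.tangent I.tangent (fun p : TangentBundle I G ↦ a * p) p (Z p) = Z (a * p)) :
    ContMDiff I.tangent I.tangent.tangent ∞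
      (fun p ↦ (⟨p, Z p⟩ : TangentBundle I.tangent (TangentBundle I G))) := by
  set e : TangentBundle I G := ⟨1, (0 : E)⟩ with he
  have h₀ : ContMDiff I.tangent I.tangent.tangent ∞
      (fun p ↦ (⟨p, (0 : E × E)⟩ : TangentBundle I.tangent (TangentBundle I G))) :=
    contMDiff_zeroSection ℝ (TangentSpace I.tangent)
  have h₁ := (contMDiff_equivTangentBundleProd_symm (I := I.tangent) (M := TangentBundle I G)
    (I' := I.tangent) (M' := TangentBundle I G) (n := ∞)).comp
    (h₀.prodMk (contMDiff_const
      (c := (⟨e, Z e⟩ : TangentBundle I.tangent (TangentBundle I G)))))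
  have h₂ : ContMDiff (I.tangent.prod I.tangent).tangent I.tangent.tangent ∞
      (tangentMap (I.tangent.prod I.tangent) I.tangent
        (fun p : TangentBundle I G × TangentBundle I G ↦ p.1 * p.2)) :=
    contMDiff_tangentMul.contMDiff_tangentMap (by simp)
  refine (h₂.comp h₁).congr fun p ↦ ?_
  have h₃ : (⟨p * e, Z (p * e)⟩ : TangentBundle I.tangent (TangentBundle I G)) = ⟨p, Z p⟩ := by
    rw [he, tangentMul_one]
  rw [← h₃]
  refine tangentBundle_ext rfl ?_
  have h₄ := mfderiv_prod_eq_add_apply (I := I.tangent) (I' := I.tangent) (I'' := I.tangent)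
    (f := fun p : TangentBundle I G × TangentBundle I G ↦ p.1 * p.2) (p := (p, e))
    (v := ((0 : E × E), (Z e : E × E)))
    (contMDiff_tangentMul.mdifferentiableAt (by simp))
  have h₅ : mfderiv I.tangent I.tangent (fun q : TangentBundle I G ↦ q * e) p 0 = 0 := map_zero _
  refine Eq.trans ?_ h₄.symm
  have h₆ := congrArg₂ (fun a b : E × E ↦ a + b) h₅ (hZ p e)
  refine Eq.trans ?_ h₆.symm
  exact (zero_add _).symm

lemma contMDiff_verticalLift (X : GroupLieAlgebra I G) :
    ContMDiff I.tangent I.tangent.tangent ∞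
      (fun p : TangentBundle I G ↦ (⟨p, verticalLift (mulInvariantVectorField X) p⟩ :
        TangentBundle I.tangent (TangentBundle I G))) :=
  contMDiff_of_tangentMul_left_invariant (mfderiv_tangentMul_left_verticalLift X)

variable [CompleteSpace E] [I.Boundaryless]

lemma contMDiff_completeLift (X : GroupLieAlgebra I G) :
    ContMDiff I.tangent I.tangent.tangent ∞
      (fun p : TangentBundle I G ↦ (⟨p, completeLift (mulInvariantVectorField X) p⟩ :
        TangentBundle I.tangent (TangentBundle I G))) :=
  contMDiff_of_tangentMul_left_invariant (mfderiv_tangentMul_left_completeLift X)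

omit [CompleteSpace E] [I.Boundaryless] in
lemma mfderiv_leftTrivialization (g : G) (v : E) (a : TangentSpace I g) (w : E) :
    mfderiv (I.prod 𝓘(ℝ, E)) I.tangent (leftTrivialization (I := I) (G := G)) (g, v)
      ((a, w) : E × E) =
    mfderiv I I.tangent
      (fun y ↦ (⟨y, mulInvariantVectorField (I := I) v y⟩ : TangentBundle I G)) g a +
    verticalVector ⟨g, mulInvariantVectorField (I := I) v g⟩
      (mulInvariantVectorField (I := I) (w : E) g) := by
  have h := mfderiv_prod_eq_add_apply (I := I) (I' := 𝓘(ℝ, E)) (I'' := I.tangent)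
    (f := leftTrivialization (I := I) (G := G)) (p := (g, v)) (v := ((a, w) : E × E))
    (contMDiff_leftTrivialization.mdifferentiableAt (by simp))
  refine h.trans ?_
  let L : E →L[ℝ] E := mfderiv I I (fun x ↦ g * x) 1
  have h₂ := (((contMDiff_fiberInclusion (I := I) g).mdifferentiableAt
    (by simp)).hasMFDerivAt.comp v L.hasMFDerivAt).mfderiv
  have h₃ := (congrArg (fun T : E →L[ℝ] E × E ↦ T w) h₂).trans
    (mfderiv_fiberInclusion g (L v) (L w))
  exact congrArg (fun z : TangentSpace I.tangent
      (⟨g, mulInvariantVectorField (I := I) v g⟩ : TangentBundle I G) ↦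
    mfderiv I I.tangent
      (fun y ↦ (⟨y, mulInvariantVectorField (I := I) v y⟩ : TangentBundle I G)) g a + z) h₃

end LiftSmooth

section LiftBracket

variable {E : Type*} [NormedAddCommGroup E] [NormedSpace ℝ E] [FiniteDimensional ℝ E]
  {H : Type*} [TopologicalSpace H] {I : ModelWithCorners ℝ E H} [I.Boundaryless]
  {G : Type*} [TopologicalSpace G] [ChartedSpace H G] [Group G] [LieGroup I ∞ G]

/-- The linear map `v ↦ ⁅v, X⁆` on the Lie algebra. -/
def lieRight (X : GroupLieAlgebra I G) : GroupLieAlgebra I G →ₗ[ℝ] GroupLieAlgebra I G :=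
  haveI := lieGroup_minSmoothness (I := I) (G := G)
  haveI : CompleteSpace E := FiniteDimensional.complete ℝ E
  { toFun := fun v ↦ ⁅v, X⁆
    map_add' := fun v w ↦ add_lie v w X
    map_smul' := fun c v ↦ smul_lie c v X }

/-- The linear vector field `v ↦ ⁅v, X⁆` on the Lie algebra. -/
def bracketRight (X : GroupLieAlgebra I G) : E →L[ℝ] E :=
  LinearMap.toContinuousLinearMap (show E →ₗ[ℝ] E from lieRight X)

omit [FiniteDimensional ℝ E] in
lemma mlieBracket_modelSpace (V W : (x : E) → TangentSpace 𝓘(ℝ, E) x) (x : E) :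
    mlieBracket 𝓘(ℝ, E) V W x = lieBracket ℝ (E := E) V W x := by
  rw [← mlieBracketWithin_univ, mlieBracketWithin_eq_lieBracketWithin]
  exact congrFun lieBracketWithin_univ x

omit [I.Boundaryless] in
lemma mlieBracket_bracketRight (X Y : GroupLieAlgebra I G) (v : E) :
    mlieBracket 𝓘(ℝ, E) (fun v ↦ bracketRight X v) (fun v ↦ bracketRight Y v) v =
      bracketRight ⁅X, Y⁆ v := by
  have := lieGroup_minSmoothness (I := I) (G := G)
  have : CompleteSpace E := FiniteDimensional.complete ℝ E
  refine (mlieBracket_modelSpace _ _ v).trans ?_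
  change fderiv ℝ (bracketRight Y) v (bracketRight X v) -
    fderiv ℝ (bracketRight X) v (bracketRight Y v) = _
  rw [ContinuousLinearMap.fderiv, ContinuousLinearMap.fderiv]
  have h : ∀ w : GroupLieAlgebra I G, ⁅⁅w, X⁆, Y⁆ - ⁅⁅w, Y⁆, X⁆ = ⁅w, ⁅X, Y⁆⁆ := by
    intro w
    rw [lie_lie w X Y, ← lie_skew X ⁅w, Y⁆]
    abel
  exact h v

omit [I.Boundaryless] in
lemma mlieBracket_bracketRight_const (X Y : GroupLieAlgebra I G) (v : E) :
    mlieBracket 𝓘(ℝ, E) (fun v ↦ bracketRight X v) (fun _ ↦ (Y : E)) v = ⁅X, Y⁆ := by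
  have := lieGroup_minSmoothness (I := I) (G := G)
  have : CompleteSpace E := FiniteDimensional.complete ℝ E
  refine (mlieBracket_modelSpace _ _ v).trans ?_
  change fderiv ℝ (fun _ : E ↦ (show E from Y)) v (bracketRight X v) -
    fderiv ℝ (bracketRight X) v (show E from Y) = _
  rw [ContinuousLinearMap.fderiv, fderiv_const_apply]
  exact (zero_sub _).trans (lie_skew X Y)

/-- The complete lift in the left trivialization. -/
def trivialCompleteLift (X : GroupLieAlgebra I G) (p : G × E) :
    TangentSpace (I.prod 𝓘(ℝ, E)) p :=
  prodField (I := I) (I' := 𝓘(ℝ, E)) (mulInvariantVectorField X) (fun v ↦ bracketRight X v) p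

/-- The vertical lift in the left trivialization. -/
def trivialVerticalLift (X : GroupLieAlgebra I G) (p : G × E) :
    TangentSpace (I.prod 𝓘(ℝ, E)) p :=
  prodField (I := I) (I' := 𝓘(ℝ, E)) (0 : (x : G) → TangentSpace I x) (fun _ ↦ (X : E)) p

lemma mfderiv_leftTrivialization_trivialCompleteLift (X : GroupLieAlgebra I G) (p : G × E) :
    mfderiv (I.prod 𝓘(ℝ, E)) I.tangent (leftTrivialization (I := I) (G := G)) p
      (trivialCompleteLift X p) =
      completeLift (mulInvariantVectorField X) (leftTrivialization p) := by
  have : CompleteSpace E := FiniteDimensional.complete ℝ E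
  refine (mfderiv_leftTrivialization p.1 p.2 (mulInvariantVectorField X p.1)
    (bracketRight X p.2)).trans ?_
  exact (completeLift_mulInvariantVectorField X p.2 p.1).symm

omit [I.Boundaryless] in
lemma mfderiv_leftTrivialization_trivialVerticalLift (X : GroupLieAlgebra I G) (p : G × E) :
    mfderiv (I.prod 𝓘(ℝ, E)) I.tangent (leftTrivialization (I := I) (G := G)) p
      (trivialVerticalLift X p) =
      verticalLift (mulInvariantVectorField X) (leftTrivialization p) := by
  have : CompleteSpace E := FiniteDimensional.complete ℝ E
  refine (mfderiv_leftTrivialization p.1 p.2 0 X).trans ?_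
  rw [map_zero, verticalLift_eq]
  exact zero_add _

omit [I.Boundaryless] in
lemma mdifferentiable_bracketRight (X : GroupLieAlgebra I G) :
    MDifferentiable 𝓘(ℝ, E) 𝓘(ℝ, E).tangent
      (fun v : E ↦ (⟨v, bracketRight X v⟩ : TangentBundle 𝓘(ℝ, E) E)) :=
  ((contMDiff_vectorSpace_iff_contDiff (n := 1)).2
    (bracketRight X).contDiff).mdifferentiable (by simp)

omit [FiniteDimensional ℝ E] in
lemma mdifferentiable_constField (Y : E) :
    MDifferentiable 𝓘(ℝ, E) 𝓘(ℝ, E).tangent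
      (fun v : E ↦ (⟨v, Y⟩ : TangentBundle 𝓘(ℝ, E) E)) :=
  ((contMDiff_vectorSpace_iff_contDiff (n := 1)).2 contDiff_const).mdifferentiable (by simp)

omit [FiniteDimensional ℝ E] [I.Boundaryless] in
lemma mdifferentiable_zeroField :
    MDifferentiable I I.tangent
      (fun y ↦ (⟨y, (0 : (x : G) → TangentSpace I x) y⟩ : TangentBundle I G)) :=
  (contMDiff_zeroSection (n := 1) ℝ (TangentSpace I)).mdifferentiable (by simp)

omit [I.Boundaryless] in
lemma mdifferentiable_trivialCompleteLift (X : GroupLieAlgebra I G) :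
    MDifferentiable (I.prod 𝓘(ℝ, E)) (I.prod 𝓘(ℝ, E)).tangent
      (fun p : G × E ↦ (⟨p, trivialCompleteLift X p⟩ : TangentBundle (I.prod 𝓘(ℝ, E)) (G × E))) :=
  mdifferentiable_prodField (mdifferentiable_mulInvariantVectorField_top X)
    (mdifferentiable_bracketRight X)

omit [FiniteDimensional ℝ E] [I.Boundaryless] in
lemma mdifferentiable_trivialVerticalLift (X : GroupLieAlgebra I G) :
    MDifferentiable (I.prod 𝓘(ℝ, E)) (I.prod 𝓘(ℝ, E)).tangent
      (fun p : G × E ↦ (⟨p, trivialVerticalLift X p⟩ : TangentBundle (I.prod 𝓘(ℝ, E)) (G × E))) :=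
  mdifferentiable_prodField mdifferentiable_zeroField (mdifferentiable_constField (E := E) (X : E))

lemma mlieBracket_trivialCompleteLift (X Y : GroupLieAlgebra I G) (p : G × E) :
    mlieBracket (I.prod 𝓘(ℝ, E)) (trivialCompleteLift X) (trivialCompleteLift Y) p =
      trivialCompleteLift ⁅X, Y⁆ p := by
  have : CompleteSpace E := FiniteDimensional.complete ℝ E
  refine (mlieBracket_prodField (mdifferentiable_mulInvariantVectorField_top X)
    (mdifferentiable_bracketRight X) (mdifferentiable_mulInvariantVectorField_top Y)
    (mdifferentiable_bracketRight Y) p).trans ?_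
  exact Prod.ext (mlieBracket_mulInvariantVectorField X Y p.1) (mlieBracket_bracketRight X Y p.2)

lemma mlieBracket_trivialCompleteLift_trivialVerticalLift (X Y : GroupLieAlgebra I G)
    (p : G × E) :
    mlieBracket (I.prod 𝓘(ℝ, E)) (trivialCompleteLift X) (trivialVerticalLift Y) p =
      trivialVerticalLift ⁅X, Y⁆ p := by
  refine (mlieBracket_prodField (mdifferentiable_mulInvariantVectorField_top X)
    (mdifferentiable_bracketRight X) mdifferentiable_zeroField
    (mdifferentiable_constField (E := E) (Y : E)) p).trans ?_
  exact Prod.ext (congrFun mlieBracket_zero_right p.1) (mlieBracket_bracketRight_const X Y p.2)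

omit [FiniteDimensional ℝ E] in
lemma mlieBracket_trivialVerticalLift (X Y : GroupLieAlgebra I G) (p : G × E) :
    mlieBracket (I.prod 𝓘(ℝ, E)) (trivialVerticalLift X) (trivialVerticalLift Y) p = 0 := by
  refine (mlieBracket_prodField mdifferentiable_zeroField
    (mdifferentiable_constField (E := E) (X : E)) mdifferentiable_zeroField
    (mdifferentiable_constField (E := E) (Y : E)) p).trans ?_
  refine Prod.ext (congrFun mlieBracket_zero_right p.1) ?_
  refine (mlieBracket_modelSpace _ _ p.2).trans ?_
  change fderiv ℝ (fun _ ↦ (Y : E)) p.2 X - fderiv ℝ (fun _ ↦ (X : E)) p.2 Y = 0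
  rw [fderiv_const_apply, fderiv_const_apply]
  exact sub_zero _

omit [FiniteDimensional ℝ E] [I.Boundaryless] in
lemma leftTrivialization_surjective (q : TangentBundle I G) :
    ∃ p : G × E, leftTrivialization p = q := by
  obtain ⟨v, hv⟩ := exists_mulInvariantVectorField_eq q.1 q.2
  exact ⟨(q.1, v), tangentBundle_ext rfl hv⟩

theorem mlieBracket_completeLift_completeLift (X Y : GroupLieAlgebra I G)
    (q : TangentBundle I G) :
    mlieBracket I.tangent (completeLift (mulInvariantVectorField X))
      (completeLift (mulInvariantVectorField Y)) q =
      completeLift (mulInvariantVectorField ⁅X, Y⁆) q := by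
  have : CompleteSpace E := FiniteDimensional.complete ℝ E
  obtain ⟨p, rfl⟩ := leftTrivialization_surjective q
  rw [← mfderiv_mlieBracket_of_related contMDiff_leftTrivialization
    (mfderiv_leftTrivialization_trivialCompleteLift X)
    (mfderiv_leftTrivialization_trivialCompleteLift Y) p
    (mdifferentiable_trivialCompleteLift X p) (mdifferentiable_trivialCompleteLift Y p)
    ((contMDiff_completeLift X).mdifferentiableAt (by simp))
    ((contMDiff_completeLift Y).mdifferentiableAt (by simp)),
    mlieBracket_trivialCompleteLift, mfderiv_leftTrivialization_trivialCompleteLift]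

theorem mlieBracket_completeLift_verticalLift (X Y : GroupLieAlgebra I G)
    (q : TangentBundle I G) :
    mlieBracket I.tangent (completeLift (mulInvariantVectorField X))
      (verticalLift (mulInvariantVectorField Y)) q =
      verticalLift (mulInvariantVectorField ⁅X, Y⁆) q := by
  have : CompleteSpace E := FiniteDimensional.complete ℝ E
  obtain ⟨p, rfl⟩ := leftTrivialization_surjective q
  rw [← mfderiv_mlieBracket_of_related contMDiff_leftTrivialization
    (mfderiv_leftTrivialization_trivialCompleteLift X)
    (mfderiv_leftTrivialization_trivialVerticalLift Y) p
    (mdifferentiable_trivialCompleteLift X p) (mdifferentiable_trivialVerticalLift Y p)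
    ((contMDiff_completeLift X).mdifferentiableAt (by simp))
    ((contMDiff_verticalLift Y).mdifferentiableAt (by simp)),
    mlieBracket_trivialCompleteLift_trivialVerticalLift,
    mfderiv_leftTrivialization_trivialVerticalLift]

theorem mlieBracket_verticalLift_verticalLift (X Y : GroupLieAlgebra I G)
    (q : TangentBundle I G) :
    mlieBracket I.tangent (verticalLift (mulInvariantVectorField X))
      (verticalLift (mulInvariantVectorField Y)) q = 0 := by
  have : CompleteSpace E := FiniteDimensional.complete ℝ E
  obtain ⟨p, rfl⟩ := leftTrivialization_surjective q
  rw [← mfderiv_mlieBracket_of_related contMDiff_leftTrivialization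
    (mfderiv_leftTrivialization_trivialVerticalLift X)
    (mfderiv_leftTrivialization_trivialVerticalLift Y) p
    (mdifferentiable_trivialVerticalLift X p) (mdifferentiable_trivialVerticalLift Y p)
    ((contMDiff_verticalLift X).mdifferentiableAt (by simp))
    ((contMDiff_verticalLift Y).mdifferentiableAt (by simp)),
    mlieBracket_trivialVerticalLift, map_zero]

end LiftBracket

section BasisForm

variable {E : Type*} [NormedAddCommGroup E] [NormedSpace ℝ E] [FiniteDimensional ℝ E]
  {ι : Type*} [Fintype ι]

/-- The bilinear form on a finite dimensional space for which a given basis is orthonormal. -/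
def basisForm (b : Module.Basis ι ℝ E) : E →L[ℝ] E →L[ℝ] ℝ :=
  ∑ a, (LinearMap.toContinuousLinearMap (b.coord a)).smulRight
    (LinearMap.toContinuousLinearMap (b.coord a))

lemma basisForm_apply (b : Module.Basis ι ℝ E) (u v : E) :
    basisForm b u v = ∑ a, b.repr u a * b.repr v a := by
  simp [basisForm]

lemma basisForm_symm (b : Module.Basis ι ℝ E) (u v : E) :
    basisForm b u v = basisForm b v u := by
  simp [basisForm_apply, mul_comm]

lemma basisForm_pos (b : Module.Basis ι ℝ E) (v : E) (hv : v ≠ 0) : 0 < basisForm b v v := by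
  rw [basisForm_apply]
  refine lt_of_le_of_ne (Finset.sum_nonneg fun a _ ↦ mul_self_nonneg _) fun h ↦ hv ?_
  have := (Finset.sum_eq_zero_iff_of_nonneg
    (fun a _ ↦ mul_self_nonneg (b.repr v a))).1 h.symm
  exact b.ext_elem fun a ↦ by simpa using this a (Finset.mem_univ a)

lemma isVonNBounded_basisForm (b : Module.Basis ι ℝ E) :
    Bornology.IsVonNBounded ℝ {v : E | basisForm b v v < 1} := by
  rw [NormedSpace.isVonNBounded_iff, isBounded_iff_forall_norm_le]
  refine ⟨∑ a, ‖b a‖, fun v hv ↦ ?_⟩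
  have hv' : ∑ a, b.repr v a * b.repr v a < 1 := by rw [← basisForm_apply]; exact hv
  have hs := norm_sum_le Finset.univ fun a ↦ b.repr v a • b a
  rw [b.sum_repr v] at hs
  refine hs.trans (Finset.sum_le_sum fun a _ ↦ ?_)
  rw [norm_smul]
  have h₁ : b.repr v a * b.repr v a ≤ ∑ a, b.repr v a * b.repr v a :=
    Finset.single_le_sum (f := fun a ↦ b.repr v a * b.repr v a)
      (fun a _ ↦ mul_self_nonneg _) (Finset.mem_univ a)
  have h₂ : ‖b.repr v a‖ ≤ 1 := by
    rw [Real.norm_eq_abs, abs_le]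
    constructor <;> nlinarith
  exact mul_le_of_le_one_left (norm_nonneg _) h₂

lemma basisForm_basis [DecidableEq ι] (b : Module.Basis ι ℝ E) (a c : ι) :
    basisForm b (b a) (b c) = if a = c then 1 else 0 := by
  simp [basisForm_apply, Finsupp.single_apply]

omit [FiniteDimensional ℝ E] [Fintype ι] in
lemma repr_equiv_symm (b₀ b : Module.Basis ι ℝ E) (w : E) (a : ι) :
    b₀.repr ((b₀.equiv b (Equiv.refl ι)).symm w) a = b.repr w a := by
  simp [Module.Basis.equiv]

end BasisForm

section FrameMetric

variable {E : Type*} [NormedAddCommGroup E] [NormedSpace ℝ E] [FiniteDimensional ℝ E]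
  {H : Type*} [TopologicalSpace H] {I : ModelWithCorners ℝ E H}
  {M : Type*} [TopologicalSpace M] [ChartedSpace H M] [IsManifold I ∞ M]
  {ι : Type*} [Fintype ι]

/-- A frame read in a trivialization, as the endomorphism of the model space that maps a fixed
basis to the frame. -/
def frameCoordinates (b₀ : Module.Basis ι ℝ E) (e : ι → (p : M) → TangentSpace I p) (x₀ x : M) :
    E →L[ℝ] E :=
  ∑ a, (LinearMap.toContinuousLinearMap (b₀.coord a)).smulRight
    (trivializationAt E (TangentSpace I) x₀ (⟨x, e a x⟩ : TangentBundle I M)).2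

lemma contMDiffAt_frameCoordinates (b₀ : Module.Basis ι ℝ E)
    {e : ι → (p : M) → TangentSpace I p}
    (he : ∀ a, ContMDiff I I.tangent ∞ (fun p ↦ (⟨p, e a p⟩ : TangentBundle I M))) (x₀ : M) :
    ContMDiffAt I 𝓘(ℝ, E →L[ℝ] E) ∞ (frameCoordinates b₀ e x₀) x₀ := by
  have h : ∀ a, ContMDiffAt I 𝓘(ℝ, E) ∞ (fun x ↦ (trivializationAt E (TangentSpace I) x₀
      (⟨x, e a x⟩ : TangentBundle I M)).2) x₀ := fun a ↦
    ((contMDiffAt_totalSpace).1 (he a x₀)).2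
  unfold frameCoordinates
  refine ContMDiffAt.sum fun a _ ↦ ?_
  have h' : ContDiff ℝ ∞ (fun u : E ↦
      (LinearMap.toContinuousLinearMap (b₀.coord a)).smulRight u) :=
    contDiff_const.smulRight contDiff_id
  exact h'.comp_contMDiffAt (h a)

lemma frameCoordinates_eq (b₀ : Module.Basis ι ℝ E) {e : ι → (p : M) → TangentSpace I p}
    (b : M → Module.Basis ι ℝ E) (hb : ∀ p a, b p a = e a p) {x₀ x : M}
    (hx : x ∈ (trivializationAt E (TangentSpace I) x₀).baseSet) :
    frameCoordinates b₀ e x₀ x =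
      ((b₀.equiv (b x) (Equiv.refl ι)).toContinuousLinearEquiv.trans
        (show E ≃L[ℝ] E from
          (trivializationAt E (TangentSpace I) x₀).continuousLinearEquivAt ℝ x hx) : E ≃L[ℝ] E) := by
  refine ContinuousLinearMap.coe_injective (b₀.ext fun a ↦ ?_)
  have h : frameCoordinates b₀ e x₀ x (b₀ a) =
      (trivializationAt E (TangentSpace I) x₀ (⟨x, e a x⟩ : TangentBundle I M)).2 := by
    classical
    simp only [frameCoordinates, sum_apply]
    rw [Finset.sum_eq_single a]
    · simp
    · intro c _ hc
      simp [hc.symm]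
    · simp
  refine h.trans ?_
  rw [← hb]
  have h' : (b₀.equiv (b x) (Equiv.refl ι)) (b₀ a) = b x a := by simp
  exact congrArg (fun v : TangentSpace I x ↦
    (trivializationAt E (TangentSpace I) x₀ (⟨x, v⟩ : TangentBundle I M)).2) h'.symm

/-- The Riemannian metric for which a smooth frame is orthonormal. -/
def frameMetric (e : ι → (p : M) → TangentSpace I p)
    (he : ∀ a, ContMDiff I I.tangent ∞ (fun p ↦ (⟨p, e a p⟩ : TangentBundle I M)))
    (b : M → Module.Basis ι ℝ E) (hb : ∀ p a, b p a = e a p) :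
    SmoothRiemannianMetric I M where
  inner p := basisForm (E := E) (b p)
  symm p := basisForm_symm (E := E) (b p)
  pos p := basisForm_pos (E := E) (b p)
  isVonNBounded p := isVonNBounded_basisForm (E := E) (b p)
  contMDiff := by
    intro x₀
    rw [contMDiffAt_hom_bundle]
    refine ⟨contMDiffAt_id, ?_⟩
    set T := trivializationAt E (TangentSpace I : M → Type _) x₀ with hT
    let b₀ : Module.Basis ι ℝ E := b x₀
    have hx₀ : x₀ ∈ T.baseSet := FiberBundle.mem_baseSet_trivializationAt' x₀
    let Q : (E →L[ℝ] E) → (E →L[ℝ] E →L[ℝ] ℝ) := fun P ↦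
      ∑ a, ((LinearMap.toContinuousLinearMap (b₀.coord a)).comp P).smulRight
        ((LinearMap.toContinuousLinearMap (b₀.coord a)).comp P)
    have hQ : ContDiff ℝ ∞ Q := by
      refine ContDiff.sum fun a _ ↦ ?_
      have := (contDiff_const (c := LinearMap.toContinuousLinearMap (b₀.coord a))).clm_comp
        (contDiff_id (𝕜 := ℝ) (E := E →L[ℝ] E) (n := ∞))
      exact this.smulRight this
    have h₁ : ContMDiffAt I 𝓘(ℝ, E →L[ℝ] E) ∞
        (fun x ↦ (frameCoordinates b₀ e x₀ x).inverse) x₀ := by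
      refine ContDiffAt.comp_contMDiffAt (g := ContinuousLinearMap.inverse) ?_
        (contMDiffAt_frameCoordinates b₀ he x₀)
      rw [frameCoordinates_eq b₀ b hb hx₀]
      exact contDiffAt_map_inverse _
    refine (hQ.comp_contMDiffAt h₁).congr_of_eventuallyEq ?_
    filter_upwards [T.open_baseSet.mem_nhds hx₀] with x hx
    have h₂ : (Q ∘ fun x ↦ (frameCoordinates b₀ e x₀ x).inverse) x =
        Q (frameCoordinates b₀ e x₀ x).inverse := rfl
    rw [h₂, frameCoordinates_eq b₀ b hb hx, ContinuousLinearMap.inverse_equiv]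
    refine ContinuousLinearMap.ext fun u ↦ ContinuousLinearMap.ext fun v ↦ ?_
    refine (inCoordinates_apply_eq₂ hx hx (Set.mem_univ _)).trans ?_
    refine (DFunLike.congr_fun (Bundle.Trivial.linearMapAt_trivialization ℝ M ℝ x)
      (basisForm (b x) (T.symm x u) (T.symm x v))).trans ?_
    refine (basisForm_apply (b x) (T.symm x u) (T.symm x v)).trans ?_
    simp only [Q, sum_apply]
    refine Finset.sum_congr rfl fun a _ ↦ ?_
    exact congrArg₂ (· * ·) (repr_equiv_symm b₀ (b x) (T.symm x u) a).symm
      (repr_equiv_symm b₀ (b x) (T.symm x v) a).symm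

end FrameMetric

section FrameConnection

variable {E : Type*} [NormedAddCommGroup E] [NormedSpace ℝ E] [FiniteDimensional ℝ E]
  {H : Type*} [TopologicalSpace H] {I : ModelWithCorners ℝ E H}
  {M : Type*} [TopologicalSpace M] [ChartedSpace H M] [IsManifold I ∞ M]
  {ι : Type*} [Fintype ι] [DecidableEq ι]

omit [FiniteDimensional ℝ E] in
lemma mdifferentiableAt_metric (g : SmoothRiemannianMetric I M)
    {Y Z : (p : M) → TangentSpace I p} {p : M}
    (hY : MDifferentiableAt I I.tangent (fun q ↦ (⟨q, Y q⟩ : TangentBundle I M)) p)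
    (hZ : MDifferentiableAt I I.tangent (fun q ↦ (⟨q, Z q⟩ : TangentBundle I M)) p) :
    MDifferentiableAt I 𝓘(ℝ, ℝ) (fun q ↦ g.inner q (Y q) (Z q)) p := by
  have : MDifferentiableAt I (I.prod 𝓘(ℝ))
      (fun m ↦ TotalSpace.mk' ℝ (E := Bundle.Trivial M ℝ) m (g.inner m (Y m) (Z m))) p := by
    apply MDifferentiableAt.clm_bundle_apply₂ (F₁ := E) (F₂ := E)
    · exact (g.contMDiff p).mdifferentiableAt (by simp)
    · exact hY
    · exact hZ
  exact ((mdifferentiableAt_totalSpace _ _).1 this).2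

/-- A smooth global orthonormal frame whose brackets have constant coefficients `γ`. -/
structure IsOrthonormalFrame (g : SmoothRiemannianMetric I M)
    (e : ι → (p : M) → TangentSpace I p) (γ : ι → ι → ι → ℝ) : Prop where
  contMDiff (a : ι) : ContMDiff I I.tangent ∞ (fun p ↦ (⟨p, e a p⟩ : TangentBundle I M))
  orthonormal (p : M) (a b : ι) : g.inner p (e a p) (e b p) = if a = b then 1 else 0
  expand (p : M) (v : TangentSpace I p) : v = ∑ a, g.inner p v (e a p) • e a p
  bracket (a b : ι) (p : M) : mlieBracket I (e a) (e b) p = ∑ c, γ a b c • e c p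

/-- The Christoffel symbols of an orthonormal frame with structure constants `γ`. -/
def frameChristoffel (γ : ι → ι → ι → ℝ) (a b c : ι) : ℝ :=
  (1 / 2) * (γ a b c - γ b c a + γ c a b)

namespace IsOrthonormalFrame

variable {g : SmoothRiemannianMetric I M} {e : ι → (p : M) → TangentSpace I p}
  {γ : ι → ι → ι → ℝ}

omit [FiniteDimensional ℝ E] in
lemma mdifferentiableAt (h : IsOrthonormalFrame g e γ) (a : ι) (p : M) :
    MDifferentiableAt I I.tangent (fun p ↦ (⟨p, e a p⟩ : TangentBundle I M)) p :=
  (h.contMDiff a p).mdifferentiableAt (by simp)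

omit [FiniteDimensional ℝ E] in
lemma inner_sum (h : IsOrthonormalFrame g e γ) (p : M) (r : ι → ℝ) (c : ι) :
    g.inner p (∑ a, r a • e a p) (e c p) = r c := by
  simp [h.orthonormal, sum_apply]

omit [FiniteDimensional ℝ E] in
lemma ext_inner (h : IsOrthonormalFrame g e γ) {p : M} {u v : TangentSpace I p}
    (huv : ∀ c, g.inner p u (e c p) = g.inner p v (e c p)) : u = v := by
  rw [h.expand p u, h.expand p v]
  exact Finset.sum_congr rfl fun a _ ↦ by rw [huv a]

omit [FiniteDimensional ℝ E] in
lemma bracket_antisymm (h : IsOrthonormalFrame g e γ) [Nonempty M] (a b c : ι) :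
    γ a b c = - γ b a c := by
  obtain ⟨p⟩ := ‹Nonempty M›
  have h₁ := h.inner_sum p (γ a b) c
  have h₂ := h.inner_sum p (γ b a) c
  rw [← h.bracket] at h₁ h₂
  rw [← h₁, ← h₂, mlieBracket_swap_apply]
  simp

lemma christoffel_eq (h : IsOrthonormalFrame g e γ)
    {nabla : CovariantDerivative I E (TangentSpace I : M → Type _)}
    (hn : IsLeviCivita g nabla) (a b : ι) (p : M) :
    nabla (e b) p (e a p) = ∑ c, frameChristoffel γ a b c • e c p := by
  have : CompleteSpace E := FiniteDimensional.complete ℝ E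
  have ht : ∀ a b c, g.inner p (nabla (e b) p (e a p)) (e c p)
      - g.inner p (nabla (e a) p (e b p)) (e c p) = γ a b c := fun a b c ↦ by
    have h₁ := nabla.torsion_eq_zero_iff.1 hn.1 (h.mdifferentiableAt a p) (h.mdifferentiableAt b p)
    rw [← h.inner_sum p (γ a b) c, ← h.bracket, ← h₁, map_sub]
    rfl
  have hm : ∀ a b c, g.inner p (nabla (e b) p (e a p)) (e c p)
      + g.inner p (nabla (e c) p (e a p)) (e b p) = 0 := fun a b c ↦ by
    have h₁ := hn.2 (e b) (e c) p (h.mdifferentiableAt b p) (h.mdifferentiableAt c p) (e a p)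
    have h₂ : (fun q ↦ g.inner q (e b q) (e c q)) = fun _ ↦ if b = c then (1 : ℝ) else 0 :=
      funext fun q ↦ h.orthonormal q b c
    rw [h₂, mvfderiv_const] at h₁
    rw [g.symm p (nabla (e c) p (e a p)), ← h₁]
    rfl
  refine h.ext_inner fun c ↦ ?_
  rw [h.inner_sum, frameChristoffel]
  linarith [ht a b c, ht b c a, ht c a b, hm a b c, hm b c a, hm c a b]

omit [FiniteDimensional ℝ E] in
lemma covariantDerivative_sum (h : IsOrthonormalFrame g e γ)
    (nabla : CovariantDerivative I E (TangentSpace I : M → Type _)) (r : ι → ℝ) (p : M)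
    (v : TangentSpace I p) :
    nabla (fun q ↦ ∑ a, r a • e a q) p v = ∑ a, r a • nabla (e a) p v := by
  have key : ∀ s : Finset ι,
      nabla (fun q ↦ ∑ a ∈ s, r a • e a q) p = ∑ a ∈ s, r a • nabla (e a) p := fun s ↦ by
    induction s using Finset.induction_on with
    | empty => exact congrFun nabla.zero p
    | insert a s ha ih =>
      have h₁ : (fun q ↦ ∑ a ∈ insert a s, r a • e a q)
          = (r a • e a) + (fun q ↦ ∑ a ∈ s, r a • e a q) :=
        funext fun q ↦ Finset.sum_insert ha
      have h₂ := nabla.isCovariantDerivativeOnUniv.add (x := p)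
        (σ := r a • e a) (σ' := fun q ↦ ∑ a ∈ s, r a • e a q)
        (MDifferentiableAt.smul_const_section (s := e a) (h.mdifferentiableAt a p))
        (MDifferentiableAt.sum_section (E := (TangentSpace I : M → Type _))
          (t := fun a q ↦ r a • e a q)
          fun a _ ↦ MDifferentiableAt.smul_const_section (s := e a) (h.mdifferentiableAt a p))
      rw [h₁, h₂, Finset.sum_insert ha, ih,
        nabla.isCovariantDerivativeOnUniv.smul_const (r a) (h.mdifferentiableAt a p)]
  simpa [sum_apply] using congrArg (fun L : TangentSpace I p →L[ℝ] TangentSpace I p ↦ L v)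
    (key Finset.univ)

/-- The curvature of a Levi-Civita connection in an orthonormal frame. -/
lemma curvature_eq (h : IsOrthonormalFrame g e γ)
    {nabla : CovariantDerivative I E (TangentSpace I : M → Type _)}
    (hn : IsLeviCivita g nabla) (a b c : ι) (p : M) :
    curvature nabla (e a) (e b) (e c) p =
      ∑ d, (∑ l, (frameChristoffel γ b c l * frameChristoffel γ a l d
        - frameChristoffel γ a c l * frameChristoffel γ b l d
        - γ a b l * frameChristoffel γ l c d)) • e d p := by
  have h₁ : ∀ a b c, nabla (fun q ↦ nabla (e c) q (e b q)) p (e a p) =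
      ∑ d, (∑ l, frameChristoffel γ b c l * frameChristoffel γ a l d) • e d p := fun a b c ↦ by
    rw [funext fun q ↦ h.christoffel_eq hn b c q, h.covariantDerivative_sum]
    simp only [h.christoffel_eq hn, Finset.smul_sum, Finset.sum_smul, mul_smul]
    exact Finset.sum_comm
  rw [curvature, h₁, h₁, h.bracket, map_sum]
  simp only [map_smul, h.christoffel_eq hn, Finset.smul_sum, Finset.sum_sub_distrib, sub_smul,
    ← mul_smul]
  congr 1
  simp only [Finset.sum_smul]
  exact Finset.sum_comm

end IsOrthonormalFrame

end FrameConnection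

section FrameLeviCivita

variable {E : Type*} [NormedAddCommGroup E] [NormedSpace ℝ E] [FiniteDimensional ℝ E]
  {H : Type*} [TopologicalSpace H] {I : ModelWithCorners ℝ E H}
  {M : Type*} [TopologicalSpace M] [ChartedSpace H M] [IsManifold I ∞ M]
  {ι : Type*} [Fintype ι] [DecidableEq ι]

/-- The covariant derivative for which an orthonormal frame is parallel. -/
def frameFlatDerivative (g : SmoothRiemannianMetric I M) (e : ι → (p : M) → TangentSpace I p)
    (Z : (p : M) → TangentSpace I p) (p : M) : TangentSpace I p →L[ℝ] TangentSpace I p :=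
  ∑ b, (mvfderiv I (fun q ↦ g.inner q (Z q) (e b q)) p).smulRight (e b p)

/-- The connection form of an orthonormal frame. -/
def frameConnectionForm (g : SmoothRiemannianMetric I M) (e : ι → (p : M) → TangentSpace I p)
    (Γ : ι → ι → ι → ℝ) (p : M) :
    TangentSpace I p →L[ℝ] TangentSpace I p →L[ℝ] TangentSpace I p :=
  ∑ a, ∑ b, ∑ c, Γ a b c • (g.inner p (e b p)).smulRight ((g.inner p (e a p)).smulRight (e c p))

namespace IsOrthonormalFrame

variable {g : SmoothRiemannianMetric I M} {e : ι → (p : M) → TangentSpace I p}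
  {γ : ι → ι → ι → ℝ}

omit [FiniteDimensional ℝ E] in
lemma isCovariantDerivativeOn_flat (h : IsOrthonormalFrame g e γ) :
    IsCovariantDerivativeOn E (frameFlatDerivative g e) Set.univ where
  add {Y Z p} hY hZ _ := by
    simp only [frameFlatDerivative, ← Finset.sum_add_distrib]
    refine Finset.sum_congr rfl fun b _ ↦ ?_
    have h₁ := mvfderiv_fun_add (mdifferentiableAt_metric g hY (h.mdifferentiableAt b p))
      (mdifferentiableAt_metric g hZ (h.mdifferentiableAt b p))
    have h₂ : (fun q ↦ g.inner q ((Y + Z) q) (e b q)) =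
        fun q ↦ g.inner q (Y q) (e b q) + g.inner q (Z q) (e b q) := by
      ext q; simp
    rw [h₂, h₁]
    ext v
    simp [add_smul]
  leibniz {Z f p} hZ hf _ := by
    have h₃ := h.expand p (Z p)
    have h₄ : ((mvfderiv I f p).smulRight (Z p) : TangentSpace I p →L[ℝ] TangentSpace I p) =
        ∑ b, g.inner p (Z p) (e b p) • (mvfderiv I f p).smulRight (e b p) := by
      ext v
      conv_lhs => rw [h₃]
      simp [sum_apply, Finset.smul_sum, smul_smul, mul_comm]
    simp only [frameFlatDerivative, h₄, Finset.smul_sum, ← Finset.sum_add_distrib]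
    refine Finset.sum_congr rfl fun b _ ↦ ?_
    have h₁ := mvfderiv_fun_mul hf (mdifferentiableAt_metric g hZ (h.mdifferentiableAt b p))
    have h₂ : (fun q ↦ g.inner q ((f • Z) q) (e b q)) =
        fun q ↦ f q * g.inner q (Z q) (e b q) := by
      ext q; simp
    rw [h₂, h₁]
    ext v
    simp [add_smul, mul_smul]

/-- The Levi-Civita connection determined by an orthonormal frame. -/
def leviCivita (h : IsOrthonormalFrame g e γ) :
    CovariantDerivative I E (TangentSpace I : M → Type _) where
  toFun Z p := frameFlatDerivative g e Z p + frameConnectionForm g e (frameChristoffel γ) p (Z p)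
  isCovariantDerivativeOnUniv := h.isCovariantDerivativeOn_flat.add_one_form _

omit [FiniteDimensional ℝ E] in
lemma inner_leviCivita (h : IsOrthonormalFrame g e γ) (Z : (p : M) → TangentSpace I p) (p : M)
    (v : TangentSpace I p) (c : ι) :
    g.inner p (h.leviCivita Z p v) (e c p) =
      mvfderiv I (fun q ↦ g.inner q (Z q) (e c q)) p v
        + ∑ a, ∑ b, frameChristoffel γ a b c * (g.inner p v (e a p) * g.inner p (Z p) (e b p)) := by
  have h₁ : g.inner p (frameFlatDerivative g e Z p v) (e c p) =
      mvfderiv I (fun q ↦ g.inner q (Z q) (e c q)) p v := by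
    rw [← h.inner_sum p (fun b ↦ mvfderiv I (fun q ↦ g.inner q (Z q) (e b q)) p v) c]
    simp [frameFlatDerivative, sum_apply]
  have h₂ : g.inner p (frameConnectionForm g e (frameChristoffel γ) p (Z p) v) (e c p) =
      ∑ a, ∑ b, frameChristoffel γ a b c * (g.inner p v (e a p) * g.inner p (Z p) (e b p)) := by
    simp [frameConnectionForm, sum_apply, h.orthonormal, g.symm p (e _ p), mul_comm]
  rw [← h₁, ← h₂]
  exact congrArg (fun L : TangentSpace I p →L[ℝ] ℝ ↦ L (e c p)) (map_add (g.inner p) _ _)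

omit [FiniteDimensional ℝ E] in
lemma inner_eq_sum (h : IsOrthonormalFrame g e γ) (p : M) (u v : TangentSpace I p) :
    g.inner p u v = ∑ b, g.inner p u (e b p) * g.inner p v (e b p) := by
  conv_lhs => rw [h.expand p v]
  simp [mul_comm]

lemma isLeviCivita (h : IsOrthonormalFrame g e γ) : IsLeviCivita g h.leviCivita := by
  have : CompleteSpace E := FiniteDimensional.complete ℝ E
  have hanti : ∀ (p : M) a b c, γ a b c = - γ b a c := fun p a b c ↦
    have : Nonempty M := ⟨p⟩
    h.bracket_antisymm a b c
  refine ⟨?_, fun Y Z p hY hZ v ↦ ?_⟩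
  · ext p u v
    have h₁ : ∀ a b, h.leviCivita.torsion p (e a p) (e b p) = 0 := fun a b ↦ by
      rw [h.leviCivita.torsion_apply (h.mdifferentiableAt a p) (h.mdifferentiableAt b p)]
      refine h.ext_inner fun c ↦ ?_
      have h₂ : ∀ a b, g.inner p (h.leviCivita (e b) p (e a p)) (e c p) =
          frameChristoffel γ a b c := fun a b ↦ by
        have h₃ : (fun q ↦ g.inner q (e b q) (e c q)) = fun _ ↦ if b = c then (1 : ℝ) else 0 :=
          funext fun q ↦ h.orthonormal q b c
        rw [h.inner_leviCivita, h₃, mvfderiv_const]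
        simp [h.orthonormal]
      have h₄ := h.inner_sum p (γ a b) c
      rw [← h.bracket] at h₄
      simp only [map_sub, map_zero, sub_apply, zero_apply, h₂, h₄]
      rw [frameChristoffel, frameChristoffel]
      linarith [hanti p a b c, hanti p b c a, hanti p c a b]
    rw [h.expand p u, h.expand p v]
    simp [sum_apply, h₁]
  · have hd : mvfderiv I (fun q ↦ g.inner q (Y q) (Z q)) p v =
        ∑ b, (g.inner p (Y p) (e b p) * mvfderiv I (fun q ↦ g.inner q (Z q) (e b q)) p v
          + g.inner p (Z p) (e b p) * mvfderiv I (fun q ↦ g.inner q (Y q) (e b q)) p v) := by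
      have hmY := fun b ↦ mdifferentiableAt_metric g hY (h.mdifferentiableAt b p)
      have hmZ := fun b ↦ mdifferentiableAt_metric g hZ (h.mdifferentiableAt b p)
      have key : ∀ s : Finset ι, MDifferentiableAt I 𝓘(ℝ, ℝ)
            (fun q ↦ ∑ b ∈ s, g.inner q (Y q) (e b q) * g.inner q (Z q) (e b q)) p ∧
          mvfderiv I (fun q ↦ ∑ b ∈ s, g.inner q (Y q) (e b q) * g.inner q (Z q) (e b q)) p v =
          ∑ b ∈ s, (g.inner p (Y p) (e b p) * mvfderiv I (fun q ↦ g.inner q (Z q) (e b q)) p v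
            + g.inner p (Z p) (e b p) * mvfderiv I (fun q ↦ g.inner q (Y q) (e b q)) p v) := by
        intro s
        induction s using Finset.induction_on with
        | empty =>
          simp only [Finset.sum_empty]
          exact ⟨mdifferentiableAt_const, by rw [mvfderiv_const]; rfl⟩
        | insert b s hb ih =>
          simp only [Finset.sum_insert hb]
          have hm := (hmY b).mul (hmZ b)
          refine ⟨hm.add ih.1, ?_⟩
          have h₁ := mvfderiv_fun_add hm ih.1
          have h₂ := mvfderiv_fun_mul (hmY b) (hmZ b)
          rw [← ih.2]
          refine (congrArg (fun L : TangentSpace I p →L[ℝ] ℝ ↦ L v) h₁).trans ?_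
          exact congrArg (· + _) (congrArg (fun L : TangentSpace I p →L[ℝ] ℝ ↦ L v) h₂)
      rw [← (key Finset.univ).2]
      congr 2
      exact funext fun q ↦ h.inner_eq_sum q (Y q) (Z q)
    rw [hd, h.inner_eq_sum p (h.leviCivita Y p v), h.inner_eq_sum p (Y p)]
    simp only [h.inner_leviCivita, add_mul, mul_add, Finset.sum_add_distrib]
    have hΓ : ∀ a b c, frameChristoffel γ a b c = - frameChristoffel γ a c b := fun a b c ↦ by
      rw [frameChristoffel, frameChristoffel]
      linarith [hanti p a b c, hanti p b c a, hanti p c a b]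
    have hc : ∑ c, (∑ a, ∑ b, frameChristoffel γ a b c *
          (g.inner p v (e a p) * g.inner p (Y p) (e b p))) * g.inner p (Z p) (e c p) =
        - ∑ c, g.inner p (Y p) (e c p) * (∑ a, ∑ b, frameChristoffel γ a b c *
          (g.inner p v (e a p) * g.inner p (Z p) (e b p))) := by
      simp only [Finset.sum_mul, Finset.mul_sum, ← Finset.sum_neg_distrib]
      rw [Finset.sum_comm]
      conv_rhs => rw [Finset.sum_comm]
      refine Finset.sum_congr rfl fun a _ ↦ ?_
      rw [Finset.sum_comm]
      refine Finset.sum_congr rfl fun b _ ↦ Finset.sum_congr rfl fun c _ ↦ ?_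
      rw [hΓ a b c]
      ring
    rw [hc]
    simp only [mul_comm (g.inner p (Z p) (e _ p))]
    ring

end IsOrthonormalFrame

end FrameLeviCivita

section LiftFrame

variable {E : Type*} [NormedAddCommGroup E] [NormedSpace ℝ E]
  {H : Type*} [TopologicalSpace H] {I : ModelWithCorners ℝ E H}
  {G : Type*} [TopologicalSpace G] [ChartedSpace H G] [Group G] [LieGroup I ∞ G]
  {ι : Type*}

lemma isLinearMap_verticalLift (p : TangentBundle I G) :
    IsLinearMap ℝ (fun X : GroupLieAlgebra I G ↦
      (verticalLift (mulInvariantVectorField X) p : E × E)) where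
  map_add X Y := by
    rw [verticalLift_eq, verticalLift_eq, verticalLift_eq, mulInvariantVectorField_add]
    exact Prod.ext (add_zero 0).symm rfl
  map_smul r X := by
    rw [verticalLift_eq, verticalLift_eq, mulInvariantVectorField_smul]
    exact Prod.ext (smul_zero r).symm rfl

/-- The frame of the tangent group made of the complete lifts and of the rescaled vertical lifts of
left invariant vector fields on the group. -/
def liftFrame (X : ι → GroupLieAlgebra I G) (lam : ι → ℝ) :
    ι ⊕ ι → (p : TangentBundle I G) → TangentSpace I.tangent p :=
  Sum.elim (fun i ↦ (1 / √(lam i)) • verticalLift (mulInvariantVectorField (X i)))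
    (fun i ↦ completeLift (mulInvariantVectorField (X i)))

/-- The structure constants of the frame of lifts, in terms of those on the group. -/
def liftStructureConstants (lam : ι → ℝ) (c : ι → ι → ι → ℝ) : ι ⊕ ι → ι ⊕ ι → ι ⊕ ι → ℝ
  | .inr i, .inr j, .inr k => c i j k
  | .inr i, .inl j, .inl k => √(lam k) / √(lam j) * c i j k
  | .inl i, .inr j, .inl k => √(lam k) / √(lam i) * c i j k
  | _, _, _ => 0

variable [FiniteDimensional ℝ E] [I.Boundaryless]

lemma isLinearMap_completeLift (p : TangentBundle I G) :
    IsLinearMap ℝ (fun X : GroupLieAlgebra I G ↦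
      (completeLift (mulInvariantVectorField X) p : E × E)) := by
  have := lieGroup_minSmoothness (I := I) (G := G)
  have : CompleteSpace E := FiniteDimensional.complete ℝ E
  obtain ⟨q, rfl⟩ := leftTrivialization_surjective p
  let L : E × E →L[ℝ] E × E :=
    mfderiv (I.prod 𝓘(ℝ, E)) I.tangent (leftTrivialization (I := I) (G := G)) q
  have h : ∀ X : GroupLieAlgebra I G, (completeLift (mulInvariantVectorField X)
      (leftTrivialization q) : E × E) = L (trivialCompleteLift X q) := fun X ↦
    (mfderiv_leftTrivialization_trivialCompleteLift X q).symm
  have h₁ : ∀ X Y : GroupLieAlgebra I G, (trivialCompleteLift (X + Y) q : E × E) =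
      (show E × E from trivialCompleteLift X q) + (show E × E from trivialCompleteLift Y q) :=
    fun X Y ↦ Prod.ext (congrFun (mulInvariantVectorField_add X Y) q.1)
      (lie_add (show GroupLieAlgebra I G from q.2) X Y)
  have h₂ : ∀ (r : ℝ) (X : GroupLieAlgebra I G), (trivialCompleteLift (r • X) q : E × E) =
      r • (show E × E from trivialCompleteLift X q) :=
    fun r X ↦ Prod.ext (congrFun (mulInvariantVectorField_smul r X) q.1)
      (lie_smul r (show GroupLieAlgebra I G from q.2) X)
  constructor
  · intro X Y
    exact (h _).trans ((congrArg L (h₁ X Y)).trans ((map_add L _ _).trans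
      (congrArg₂ (fun a b : E × E ↦ a + b) (h X).symm (h Y).symm)))
  · intro r X
    exact (h _).trans ((congrArg L (h₂ r X)).trans ((map_smul L _ _).trans
      (congrArg (fun a : E × E ↦ r • a) (h X).symm)))

lemma completeLift_sum [Fintype ι] (x : ι → ℝ) (X : ι → GroupLieAlgebra I G)
    (p : TangentBundle I G) :
    completeLift (mulInvariantVectorField (∑ i, x i • X i)) p =
      ∑ i, x i • completeLift (mulInvariantVectorField (X i)) p := by
  have h := map_sum (isLinearMap_completeLift p).mk' (fun i ↦ x i • X i) Finset.univ
  simp only [map_smul] at h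
  exact h

omit [FiniteDimensional ℝ E] [I.Boundaryless] in
lemma verticalLift_sum [Fintype ι] (x : ι → ℝ) (X : ι → GroupLieAlgebra I G)
    (p : TangentBundle I G) :
    verticalLift (mulInvariantVectorField (∑ i, x i • X i)) p =
      ∑ i, x i • verticalLift (mulInvariantVectorField (X i)) p := by
  have h := map_sum (isLinearMap_verticalLift p).mk' (fun i ↦ x i • X i) Finset.univ
  simp only [map_smul] at h
  exact h

lemma contMDiff_liftFrame (X : ι → GroupLieAlgebra I G) (lam : ι → ℝ) (a : ι ⊕ ι) :
    ContMDiff I.tangent I.tangent.tangent ∞ (fun p ↦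
      (⟨p, liftFrame X lam a p⟩ : TangentBundle I.tangent (TangentBundle I G))) := by
  have : CompleteSpace E := FiniteDimensional.complete ℝ E
  rcases a with i | i
  · exact ContMDiff.smul_section contMDiff_const (contMDiff_verticalLift (X i))
  · exact contMDiff_completeLift (X i)

lemma mfderiv_tangentMul_left_liftFrame (X : ι → GroupLieAlgebra I G) (lam : ι → ℝ) (a : ι ⊕ ι)
    (p q : TangentBundle I G) :
    mfderiv I.tangent I.tangent (fun q : TangentBundle I G ↦ p * q) q (liftFrame X lam a q) =
      liftFrame X lam a (p * q) := by
  have : CompleteSpace E := FiniteDimensional.complete ℝ E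
  rcases a with i | i
  · refine (map_smul (mfderiv I.tangent I.tangent (fun q : TangentBundle I G ↦ p * q) q) _
      (verticalLift (mulInvariantVectorField (X i)) q)).trans ?_
    rw [mfderiv_tangentMul_left_verticalLift]
    rfl
  · exact mfderiv_tangentMul_left_completeLift (X i) p q

lemma mlieBracket_verticalLift_completeLift (X Y : GroupLieAlgebra I G) (p : TangentBundle I G) :
    mlieBracket I.tangent (verticalLift (mulInvariantVectorField X))
      (completeLift (mulInvariantVectorField Y)) p =
      verticalLift (mulInvariantVectorField ⁅X, Y⁆) p := by
  rw [mlieBracket_swap_apply, mlieBracket_completeLift_verticalLift]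
  have := lieGroup_minSmoothness (I := I) (G := G)
  have : CompleteSpace E := FiniteDimensional.complete ℝ E
  rw [← lie_skew X Y]
  exact ((isLinearMap_verticalLift p).map_neg ⁅Y, X⁆).symm

lemma mlieBracket_liftFrame [Fintype ι] (X : ι → GroupLieAlgebra I G) {lam : ι → ℝ}
    (hlam : ∀ i, 0 < lam i) {c : ι → ι → ι → ℝ} (hc : ∀ i j, ⁅X i, X j⁆ = ∑ k, c i j k • X k)
    (a b : ι ⊕ ι) (p : TangentBundle I G) :
    mlieBracket I.tangent (liftFrame X lam a) (liftFrame X lam b) p =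
      ∑ d, liftStructureConstants lam c a b d • liftFrame X lam d p := by
  have : CompleteSpace E := FiniteDimensional.complete ℝ E
  have hs : ∀ i, √(lam i) ≠ 0 := fun i ↦ (Real.sqrt_pos.2 (hlam i)).ne'
  have hv : ∀ i, MDifferentiableAt I.tangent I.tangent.tangent (fun p ↦
      (⟨p, verticalLift (mulInvariantVectorField (X i)) p⟩ :
        TangentBundle I.tangent (TangentBundle I G))) p := fun i ↦
    (contMDiff_verticalLift (X i) p).mdifferentiableAt (by simp)
  have hsum : ∀ i j l, (1 / √(lam l)) • verticalLift (mulInvariantVectorField ⁅X i, X j⁆) p =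
      ∑ k, (√(lam k) / √(lam l) * c i j k) • liftFrame X lam (.inl k) p := fun i j l ↦ by
    rw [hc, verticalLift_sum, Finset.smul_sum]
    refine Finset.sum_congr rfl fun k _ ↦ ?_
    refine Eq.trans ?_ (smul_smul (√(lam k) / √(lam l) * c i j k) (1 / √(lam k)) _).symm
    rw [smul_smul]
    congr 1
    field_simp [hs k, hs l]
  have hcv : ∀ i j, mlieBracket I.tangent (liftFrame X lam (.inr i)) (liftFrame X lam (.inl j)) p =
      ∑ k, (√(lam k) / √(lam j) * c i j k) • liftFrame X lam (.inl k) p := fun i j ↦ by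
    refine (mlieBracket_const_smul_right (hv j)).trans ?_
    refine (congrArg _ (mlieBracket_completeLift_verticalLift (X i) (X j) p)).trans ?_
    exact hsum i j j
  simp only [Fintype.sum_sum_type]
  rcases a with i | i <;> rcases b with j | j
  · simp only [liftStructureConstants, zero_smul, Finset.sum_const_zero, add_zero]
    refine (mlieBracket_const_smul_right (hv j)).trans ?_
    refine (congrArg _ (mlieBracket_const_smul_left (hv i))).trans ?_
    refine (congrArg _ (congrArg _ (mlieBracket_verticalLift_verticalLift (X i) (X j) p))).trans ?_
    rw [smul_zero, smul_zero]
  · simp only [liftStructureConstants, zero_smul, Finset.sum_const_zero, add_zero]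
    refine (mlieBracket_const_smul_left (hv i)).trans ?_
    exact (congrArg _ (mlieBracket_verticalLift_completeLift (X i) (X j) p)).trans (hsum i j i)
  · simp only [liftStructureConstants, zero_smul, Finset.sum_const_zero, add_zero]
    exact hcv i j
  · simp only [liftStructureConstants, zero_smul, Finset.sum_const_zero, zero_add]
    refine (mlieBracket_completeLift_completeLift (X i) (X j) p).trans ?_
    rw [hc, completeLift_sum]
    rfl

omit [I.Boundaryless] in
/-- Left invariant vector fields that form a basis of the Lie algebra form a basis at each point. -/
lemma exists_basis_mulInvariantVectorField [Fintype ι]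
    (X : Module.Basis ι ℝ (GroupLieAlgebra I G)) (g : G) :
    ∃ B : Module.Basis ι ℝ E, ∀ i, B i = mulInvariantVectorField (X i) g := by
  let D : E →L[ℝ] E := mfderiv I I (fun x : G ↦ g * x) 1
  let L : E →ₗ[ℝ] E := D.toLinearMap
  have hL : Function.Surjective L := fun w ↦ exists_mulInvariantVectorField_eq (I := I) g w
  have hL' : Function.Injective L := LinearMap.injective_iff_surjective.2 hL
  let X' : Module.Basis ι ℝ E := X
  exact ⟨X'.map (LinearEquiv.ofBijective L ⟨hL', hL⟩), fun i ↦ X'.map_apply _ i⟩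

omit [I.Boundaryless] in
lemma exists_basis_triangular [Fintype ι] (B : Module.Basis ι ℝ E) (z : ι → E) (r : ι → ℝ)
    (hr : ∀ i, r i ≠ 0) :
    ∃ b : Module.Basis (ι ⊕ ι) ℝ (E × E),
      (∀ i, b (.inl i) = (0, r i • B i)) ∧ ∀ i, b (.inr i) = (B i, z i) := by
  have hli : LinearIndependent ℝ
      (Sum.elim (fun i ↦ ((0, r i • B i) : E × E)) (fun i ↦ (B i, z i))) := by
    rw [Fintype.linearIndependent_iff]
    intro x hx
    simp only [Fintype.sum_sum_type, Sum.elim_inl, Sum.elim_inr] at hx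
    have h₁ := congrArg Prod.fst hx
    have h₂ := congrArg Prod.snd hx
    simp only [Prod.fst_add, Prod.snd_add, Prod.fst_sum, Prod.snd_sum, Prod.smul_fst,
      Prod.smul_snd, smul_zero, Finset.sum_const_zero, zero_add, Prod.fst_zero,
      Prod.snd_zero] at h₁ h₂
    have h₃ := Fintype.linearIndependent_iff.1 B.linearIndependent _ h₁
    simp only [h₃, zero_smul, Finset.sum_const_zero, add_zero, smul_smul] at h₂
    have h₄ := Fintype.linearIndependent_iff.1 B.linearIndependent _ h₂
    rintro (i | i)
    · exact (mul_eq_zero.1 (h₄ i)).resolve_right (hr i)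
    · exact h₃ i
  have hcard : Fintype.card (ι ⊕ ι) = Module.finrank ℝ (E × E) := by
    rw [Fintype.card_sum, Module.finrank_prod, Module.finrank_eq_card_basis B]
  rcases isEmpty_or_nonempty (ι ⊕ ι) with h | h
  · have : Subsingleton (E × E) := by
      rw [Fintype.card_eq_zero] at hcard
      exact Module.finrank_zero_iff.1 hcard.symm
    exact ⟨Module.Basis.empty _, fun i ↦ (h.false (.inl i)).elim, fun i ↦ (h.false (.inl i)).elim⟩
  · refine ⟨basisOfLinearIndependentOfCardEqFinrank hli hcard, fun i ↦ ?_, fun i ↦ ?_⟩ <;> simp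

omit [I.Boundaryless] in
lemma exists_basis_liftFrame [Fintype ι] (X : Module.Basis ι ℝ (GroupLieAlgebra I G))
    {lam : ι → ℝ} (hlam : ∀ i, 0 < lam i) (p : TangentBundle I G) :
    ∃ b : Module.Basis (ι ⊕ ι) ℝ (E × E), ∀ a, b a = liftFrame X lam a p := by
  obtain ⟨B, hB⟩ := exists_basis_mulInvariantVectorField X p.1
  obtain ⟨b, hl, hr⟩ := exists_basis_triangular B
    (fun i ↦ (completeLift (mulInvariantVectorField (X i)) p : E × E).2) (fun i ↦ 1 / √(lam i))
    fun i ↦ (one_div_pos.2 (Real.sqrt_pos.2 (hlam i))).ne'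
  refine ⟨b, ?_⟩
  rintro (i | i)
  · rw [hl, hB]
    refine Eq.trans ?_ (congrArg (fun w : E × E ↦ (1 / √(lam i)) • w)
      (verticalLift_eq (mulInvariantVectorField (X i)) p)).symm
    exact Prod.ext (smul_zero _).symm rfl
  · rw [hr, hB]
    rfl

end LiftFrame

section LiftedMetric

lemma bilin_comp_eq_of_basis {E F ι : Type*} [AddCommGroup E] [Module ℝ E] [AddCommGroup F]
    [Module ℝ F] (b : Module.Basis ι ℝ E)
    (B : F →ₗ[ℝ] F →ₗ[ℝ] ℝ) (C : E →ₗ[ℝ] E →ₗ[ℝ] ℝ) (L L' : E →ₗ[ℝ] F)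
    (h : ∀ i j, B (L (b i)) (L' (b j)) = C (b i) (b j)) (u v : E) :
    B (L u) (L' v) = C u v := by
  have : B.compl₁₂ L L' = C := LinearMap.ext_basis b b fun i j ↦ h i j
  exact congrArg (fun D : E →ₗ[ℝ] E →ₗ[ℝ] ℝ ↦ D u v) this

variable {E : Type*} [NormedAddCommGroup E] [NormedSpace ℝ E] [FiniteDimensional ℝ E]
  {H : Type*} [TopologicalSpace H] {I : ModelWithCorners ℝ E H} [I.Boundaryless]
  {G : Type*} [TopologicalSpace G] [ChartedSpace H G] [Group G] [LieGroup I ∞ G]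
  {ι : Type*} [Fintype ι] [DecidableEq ι]

/-- A metric at a point, as a bilinear form on the model space. -/
def metricForm {E : Type*} [NormedAddCommGroup E] [NormedSpace ℝ E]
    {H : Type*} [TopologicalSpace H] {I : ModelWithCorners ℝ E H}
    {M : Type*} [TopologicalSpace M] [ChartedSpace H M] [IsManifold I ∞ M]
    (g : SmoothRiemannianMetric I M) (p : M) : E →ₗ[ℝ] E →ₗ[ℝ] ℝ :=
  LinearMap.mk₂ ℝ (fun u v : E ↦ g.inner p u v)
    (fun u u' v ↦ congrArg (fun L : E →L[ℝ] ℝ ↦ L v) (map_add (g.inner p) u u'))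
    (fun r u v ↦ congrArg (fun L : E →L[ℝ] ℝ ↦ L v) (map_smul (g.inner p) r u))
    (fun u v v' ↦ map_add (g.inner p u) v v') (fun r u v ↦ map_smul (g.inner p u) r v)

omit [FiniteDimensional ℝ E] [I.Boundaryless] [Fintype ι] in
lemma IsLiftedMetric.inner_liftFrame_inl {g₁ g₂ : SmoothRiemannianMetric I G}
    {gt : SmoothRiemannianMetric I.tangent (TangentBundle I G)}
    {X : ι → GroupLieAlgebra I G} {lam : ι → ℝ} (hlam : ∀ i, 0 < lam i)
    (hX₂ : ∀ i j, g₂.inner 1 (X i) (X j) = if i = j then lam i else 0)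
    (h : IsLiftedMetric g₁ g₂ gt) (p : TangentBundle I G) (i j : ι) :
    gt.inner p (liftFrame X lam (.inl i) p) (liftFrame X lam (.inl j) p) =
      if i = j then 1 else 0 := by
  have h₁ : gt.inner p (liftFrame X lam (.inl i) p) (liftFrame X lam (.inl j) p) =
      (1 / √(lam i)) * ((1 / √(lam j)) * g₂.inner 1 (X i) (X j)) := by
    rw [← h.vertical_vertical (X i) (X j) p]
    simp [liftFrame, mul_left_comm]
  rw [h₁, hX₂]
  split_ifs with hij
  · subst hij
    have := Real.mul_self_sqrt (hlam i).le
    have h₀ : √(lam i) ≠ 0 := (Real.sqrt_pos.2 (hlam i)).ne'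
    field_simp
    rw [sq, this]
  · simp

lemma IsLiftedMetric.isOrthonormalFrame {g₁ g₂ : SmoothRiemannianMetric I G}
    {gt : SmoothRiemannianMetric I.tangent (TangentBundle I G)}
    (X : Module.Basis ι ℝ (GroupLieAlgebra I G)) {lam : ι → ℝ} (hlam : ∀ i, 0 < lam i)
    (hX₁ : ∀ i j, g₁.inner 1 (X i) (X j) = if i = j then 1 else 0)
    (hX₂ : ∀ i j, g₂.inner 1 (X i) (X j) = if i = j then lam i else 0)
    {c : ι → ι → ι → ℝ} (hc : ∀ i j, ⁅X i, X j⁆ = ∑ k, c i j k • X k)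
    (h : IsLiftedMetric g₁ g₂ gt) :
    IsOrthonormalFrame gt (liftFrame X lam) (liftStructureConstants lam c) := by
  have ho : ∀ (p : TangentBundle I G) (a b : ι ⊕ ι),
      gt.inner p (liftFrame X lam a p) (liftFrame X lam b p) = if a = b then 1 else 0 := by
    have hcv : ∀ (p : TangentBundle I G) (i j : ι),
        gt.inner p (liftFrame X lam (.inr i) p) (liftFrame X lam (.inl j) p) = 0 := fun p i j ↦ by
      have := h.complete_vertical (X i) (X j) p
      simp [liftFrame, this]
    rintro p (i | i) (j | j)
    · rw [IsLiftedMetric.inner_liftFrame_inl hlam hX₂ h p i j]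
      simp
    · rw [gt.symm, hcv]
      simp
    · rw [hcv]
      simp
    · refine (h.complete_complete (X i) (X j) p).trans ?_
      rw [hX₁]
      simp
  refine ⟨contMDiff_liftFrame X lam, ho, fun p v ↦ ?_, mlieBracket_liftFrame X hlam hc⟩
  obtain ⟨b, hb⟩ := exists_basis_liftFrame X hlam p
  have hv : v = ∑ a, b.repr v a • liftFrame X lam a p := by
    have := (b.sum_repr v).symm
    simp only [hb] at this
    exact this
  have hr : ∀ a, gt.inner p v (liftFrame X lam a p) = b.repr v a := fun a ↦ by
    conv_lhs => rw [hv]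
    simp [sum_apply, ho, -Fintype.sum_sum_type]
  simp only [hr]
  exact hv

lemma exists_isLiftedMetric {g₁ g₂ : SmoothRiemannianMetric I G}
    (X : Module.Basis ι ℝ (GroupLieAlgebra I G)) {lam : ι → ℝ} (hlam : ∀ i, 0 < lam i)
    (hX₁ : ∀ i j, g₁.inner 1 (X i) (X j) = if i = j then 1 else 0)
    (hX₂ : ∀ i j, g₂.inner 1 (X i) (X j) = if i = j then lam i else 0) :
    ∃ gt : SmoothRiemannianMetric I.tangent (TangentBundle I G), IsLiftedMetric g₁ g₂ gt := by
  choose b hb using fun p : TangentBundle I G ↦ exists_basis_liftFrame X hlam p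
  let gt := frameMetric (liftFrame X lam) (contMDiff_liftFrame X lam) b hb
  have ho : ∀ (p : TangentBundle I G) (a c : ι ⊕ ι),
      gt.inner p (liftFrame X lam a p) (liftFrame X lam c p) = if a = c then 1 else 0 :=
    fun p a c ↦ by
      have := basisForm_basis (b p) a c
      rw [hb, hb] at this
      exact this
  have hs : ∀ i, √(lam i) ≠ 0 := fun i ↦ (Real.sqrt_pos.2 (hlam i)).ne'
  have hV : ∀ (p : TangentBundle I G) (i : ι), verticalLift (mulInvariantVectorField (X i)) p =
      √(lam i) • liftFrame X lam (.inl i) p := fun p i ↦ by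
    refine Eq.trans ?_ (smul_smul (√(lam i)) (1 / √(lam i))
      (verticalLift (mulInvariantVectorField (X i)) p)).symm
    rw [mul_one_div_cancel (hs i), one_smul]
  have hC : ∀ (p : TangentBundle I G) (i : ι), completeLift (mulInvariantVectorField (X i)) p =
      liftFrame X lam (.inr i) p := fun p i ↦ rfl
  let X' : Module.Basis ι ℝ E := X
  refine ⟨gt, ?_, fun Y Z p ↦ ?_, fun Y Z p ↦ ?_, fun Y Z p ↦ ?_⟩
  · intro q p u v
    let D : E × E →L[ℝ] E × E := mfderiv I.tangent I.tangent (fun p : TangentBundle I G ↦ q * p) p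
    refine bilin_comp_eq_of_basis (b p) (metricForm gt (q * p)) (metricForm gt p)
      D.toLinearMap D.toLinearMap (fun a c ↦ ?_) u v
    rw [hb, hb]
    refine Eq.trans ?_ (ho p a c).symm
    refine Eq.trans ?_ (ho (q * p) a c)
    exact congrArg₂ (fun u v : E × E ↦ metricForm gt (q * p) u v)
      (mfderiv_tangentMul_left_liftFrame X lam a q p)
      (mfderiv_tangentMul_left_liftFrame X lam c q p)
  · refine bilin_comp_eq_of_basis X' (metricForm gt p) (metricForm g₁ 1)
      (isLinearMap_completeLift p).mk' (isLinearMap_completeLift p).mk' (fun i j ↦ ?_) Y Z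
    refine Eq.trans ?_ (hX₁ i j).symm
    refine (ho p (.inr i) (.inr j)).trans ?_
    simp
  · refine bilin_comp_eq_of_basis X' (metricForm gt p) (metricForm g₂ 1)
      (isLinearMap_verticalLift p).mk' (isLinearMap_verticalLift p).mk' (fun i j ↦ ?_) Y Z
    refine Eq.trans ?_ (hX₂ i j).symm
    have h₁ : gt.inner p (verticalLift (mulInvariantVectorField (X i)) p)
        (verticalLift (mulInvariantVectorField (X j)) p) = if i = j then lam i else 0 := by
      rw [hV, hV]
      simp only [map_smul, smul_apply, ho, smul_eq_mul, Sum.inl.injEq]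
      split_ifs with hij
      · subst hij
        rw [mul_one, Real.mul_self_sqrt (hlam i).le]
      · simp
    exact h₁
  · refine bilin_comp_eq_of_basis X' (metricForm gt p) 0
      (isLinearMap_completeLift p).mk' (isLinearMap_verticalLift p).mk' (fun i j ↦ ?_) Y Z
    have h₁ : gt.inner p (completeLift (mulInvariantVectorField (X i)) p)
        (verticalLift (mulInvariantVectorField (X j)) p) = 0 := by
      rw [hC, hV]
      simp [ho]
    exact h₁

end LiftedMetric

end

theorem theorem4p2 {n : ℕ}
    {E : Type*} [NormedAddCommGroup E] [NormedSpace ℝ E] [FiniteDimensional ℝ E]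
    {G : Type*} [TopologicalSpace G] [ChartedSpace E G] [Group G] [LieGroup 𝓘(ℝ, E) ∞ G]
    (g₁ g₂ : SmoothRiemannianMetric 𝓘(ℝ, E) G)
    (hg₁ : IsLeftInvariantMetric g₁) (hg₂ : IsLeftInvariantMetric g₂)
    -- the symmetric map relating the two inner products on the Lie algebra of `G`
    (φ : GroupLieAlgebra 𝓘(ℝ, E) G →ₗ[ℝ] GroupLieAlgebra 𝓘(ℝ, E) G)
    (hφ : ∀ U V : GroupLieAlgebra 𝓘(ℝ, E) G, g₂.inner 1 U V = g₁.inner 1 (φ U) V)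
    -- an orthonormal basis, for the first inner product, of eigenvectors of this map
    (X : Module.Basis (Fin n) ℝ (GroupLieAlgebra 𝓘(ℝ, E) G))
    (hX : ∀ i j, g₁.inner 1 (X i) (X j) = if i = j then 1 else 0)
    (lam : Fin n → ℝ) (hlam : ∀ i, φ (X i) = lam i • X i)
    -- the structure constants: `c i j k` is the coefficient of `X k` in the bracket of `X i`, `X j`
    (c : Fin n → Fin n → Fin n → ℝ) (hc : ∀ i j, ⁅X i, X j⁆ = ∑ k, c i j k • X k) :
    (∃ gt : SmoothRiemannianMetric 𝓘(ℝ, E).tangent (TangentBundle 𝓘(ℝ, E) G),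
      IsLiftedMetric g₁ g₂ gt) ∧
    ∀ gt : SmoothRiemannianMetric 𝓘(ℝ, E).tangent (TangentBundle 𝓘(ℝ, E) G),
      IsLiftedMetric g₁ g₂ gt →
      (∃ nabla, IsLeviCivita gt nabla) ∧
      ∀ nabla, IsLeviCivita gt nabla →
        ∀ (Xv Xc : Fin n → (p : TangentBundle 𝓘(ℝ, E) G) → TangentSpace 𝓘(ℝ, E).tangent p),
        -- `Xv i` is the normalized vertical lift of `X i`, and `Xc i` is the complete lift
        (∀ i, Xv i = (1 / √(lam i)) • verticalLift (mulInvariantVectorField (X i))) →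
        (∀ i, Xc i = completeLift (mulInvariantVectorField (X i))) →
        ∀ i j k : Fin n,
          curvature nabla (Xc i) (Xc j) (Xc k) =
              ∑ h, ((1 / 4 : ℝ) * ∑ l,
                ((c j k l - c k l j + c l j k) * (c i l h - c l h i + c h i l)
                - (c i k l - c k l i + c l i k) * (c j l h - c l h j + c h j l)
                - 2 * c i j l * (c l k h - c k h l + c h l k))) • Xc h ∧
          curvature nabla (Xc i) (Xc j) (Xv k) =
              ∑ h, ((1 / 4 : ℝ) * ∑ l,
                ((√(lam l) / √(lam k) * c j k l + √(lam k) / √(lam l) * c l j k)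
                  * (√(lam h) / √(lam l) * c i l h + √(lam l) / √(lam h) * c h i l)
                - (√(lam l) / √(lam k) * c i k l + √(lam k) / √(lam l) * c l i k)
                  * (√(lam h) / √(lam l) * c j l h + √(lam l) / √(lam h) * c h j l)
                - 2 * c i j l
                  * (√(lam h) / √(lam k) * c l k h + √(lam k) / √(lam h) * c h l k))) • Xv h ∧
          curvature nabla (Xv i) (Xc j) (Xc k) =
              ∑ h, ((1 / 4 : ℝ) * ∑ l,
                ((c j k l - c k l j + c l j k)
                  * (√(lam h) / √(lam i) * c i l h - √(lam i) / √(lam h) * c l h i)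
                - (√(lam l) / √(lam i) * c i k l - √(lam i) / √(lam l) * c k l i)
                  * (√(lam h) / √(lam l) * c j l h + √(lam l) / √(lam h) * c h j l)
                - 2 * (√(lam l) / √(lam i)) * c i j l
                  * (√(lam h) / √(lam l) * c l k h - √(lam l) / √(lam h) * c k h l))) • Xv h ∧
          curvature nabla (Xv i) (Xv j) (Xc k) =
              ∑ h, ((1 / 4 : ℝ) * ∑ l,
                ((√(lam l) / √(lam j) * c j k l - √(lam j) / √(lam l) * c k l j)
                  * (√(lam l) / √(lam i) * c h i l - √(lam i) / √(lam l) * c l h i)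
                - (√(lam l) / √(lam i) * c i k l - √(lam i) / √(lam l) * c k l i)
                  * (√(lam l) / √(lam j) * c h j l - √(lam j) / √(lam l) * c l h j))) • Xc h ∧
          curvature nabla (Xv i) (Xc j) (Xv k) =
              ∑ h, ((1 / 4 : ℝ) * ∑ l,
                ((√(lam l) / √(lam k) * c j k l + √(lam k) / √(lam l) * c l j k)
                  * (√(lam l) / √(lam i) * c h i l - √(lam i) / √(lam l) * c l h i)
                - (√(lam k) / √(lam i) * c l i k - √(lam i) / √(lam k) * c k l i)
                  * (c j l h - c l h j + c h j l)
                - 2 * (√(lam l) / √(lam i)) * c i j l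
                  * (√(lam k) / √(lam l) * c h l k - √(lam l) / √(lam k) * c k h l))) • Xc h ∧
          curvature nabla (Xv i) (Xv j) (Xv k) =
              ∑ h, ((1 / 4 : ℝ) * ∑ l,
                ((√(lam k) / √(lam j) * c l j k - √(lam j) / √(lam k) * c k l j)
                  * (√(lam h) / √(lam i) * c i l h - √(lam i) / √(lam h) * c l h i)
                - (√(lam k) / √(lam i) * c l i k - √(lam i) / √(lam k) * c k l i)
                  * (√(lam h) / √(lam j) * c j l h - √(lam j) / √(lam h) * c l h j))) • Xv h := by
  have hX₂ : ∀ i j, g₂.inner 1 (X i) (X j) = if i = j then lam i else 0 := fun i j ↦ by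
    rw [hφ, hlam, map_smul, smul_apply, hX]
    simp
  have hpos : ∀ i, 0 < lam i := fun i ↦ by
    have := g₂.pos 1 (X i) (X.ne_zero i)
    rwa [hX₂, if_pos rfl] at this
  refine ⟨exists_isLiftedMetric X hpos hX hX₂, fun gt hgt ↦ ?_⟩
  have hF := hgt.isOrthonormalFrame X hpos hX hX₂ hc
  refine ⟨⟨hF.leviCivita, hF.isLeviCivita⟩, fun nabla hn Xv Xc hXv hXc i j k ↦ ?_⟩
  have hv : ∀ i, Xv i = liftFrame X lam (.inl i) := hXv
  have hcm : ∀ i, Xc i = liftFrame X lam (.inr i) := hXc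
  simp only [hv, hcm]
  refine ⟨?_, ?_, ?_, ?_, ?_, ?_⟩ <;>
  · funext p
    refine (hF.curvature_eq hn _ _ _ p).trans ?_
    simp only [Fintype.sum_sum_type, frameChristoffel, liftStructureConstants, mul_zero, zero_mul,
      sub_zero, add_zero, zero_add, zero_sub, neg_zero, Finset.sum_const_zero, zero_smul,
      Finset.sum_apply, Pi.smul_apply, Finset.mul_sum,
      ← Finset.sum_add_distrib]
    refine Finset.sum_congr rfl fun h _ ↦ congrArg (· • _) (Finset.sum_congr rfl fun l _ ↦ ?_)
    ring
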